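/- Let $\omega:\mathbb R\to\mathbb C$ be an integrable pulse and, for each frequency $z\in\mathbb R$, let $M_-(z;\cdot):\mathbb R\to\mathbb R^3$ be the solution of the Bloch equation $$\frac{d}{dt}M_-(z;t)=M_-(z;t)\times\begin{pmatrix}\operatorname{Re}\omega(t)\\ \operatorname{Im}\omega(t)\\ z\end{pmatrix},\qquad \lim_{t\to-\infty}M_-(z;t)=\begin{pmatrix}0\\0\\1\end{pmatrix}$$ (solutions are continuous and satisfy the integrated equation). The selective excitation transform $\mathcal T\omega=\mathbf M:\mathbb R\to S^2\subset\mathbb R^3$ is $$\mathbf M(z)=\lim_{t\to+\infty}\begin{pmatrix}\cos zt&-\sin zt&0\\ \sin zt&\cos zt&0\\0&0&1\end{pmatrix}M_-(z;t).$$ The pulse has rephasing time $\rho\in\mathbb R$ if $\omega(t)=0$ for almost every $t>\rho$. Let $\mathbf M=(\mathbf M_x,\mathbf M_y,\mathbf M_z):\mathbb R\to S^2$ be a magnetization profile with $\mathbf M_z\neq-1$ everywhere, and let $$r(\xi)=\frac{\mathbf M_x(2\xi)-i\,\mathbf M_y(2\xi)}{1+\mathbf M_z(2\xi)},\qquad \xi\in\mathbb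 R,$$ be its reflection coefficient. Assume that $r$ and $\xi r$ are in the Sobolev space $H^1(\mathbb R)$, and that $r(\xi)=e^{-2i\xi\rho}r_0(\xi)$ for some $\rho\in\mathbb R$, where $r_0$ has a meromorphic extension to the open upper half plane (with boundary values $r_0$ on $\mathbb R$) that has finitely many poles there and tends to $0$ as $|\xi|\to\infty$ in the upper half plane. Let $\xi_1,\dots,\xi_m$ be the distinct poles of this extension in the upper half plane, and $d_1,\dots,d_m$ their multiplicities. Then every integrable pulse $\omega$ with rephasing time $\rho$ and $\mathcal T\omega=\mathbf M$ is square integrable, $\log(1+|r|^2)$ is integrable, and the energy of $\omega$ is $$E_\omega=\int_{-\infty}^{\infty}|\omega(t)|^2\,dt=\frac4\pi\int_{-\infty}^{\infty}\log\bigl(1+|r(\xi)|^2\bigr)\,d\xi+16\sum_{k=1}^m d_k\operatorname{Im}\xi_k .$$ -/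

import Mathlib

open MeasureTheory Filter Topology
open scoped Matrix

noncomputable section

/-- The energy `∫ |ω(t)|² dt` of a pulse `ω : ℝ → ℂ`. -/
def pulseEnergy (ω : ℝ → ℂ) : ℝ := ∫ t, ‖ω t‖ ^ 2

/-- `m : ℝ → ℝ³` solves the Bloch equation `dm/dt = m × (Re ω, Im ω, z)` at the frequency `z`,
in the sense of Carathéodory, as is appropriate for a pulse `ω` that is only integrable: `m` is
continuous and satisfies the integrated equation. (If `ω` is continuous, these are exactly the
classical solutions.) -/
def IsBlochSolution (ω : ℝ → ℂ) (z : ℝ) (m : ℝ → Fin 3 → ℝ) : Prop :=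
  Continuous m ∧
    ∀ s t : ℝ, m t - m s = ∫ τ in s..t, m τ ⨯₃ ![(ω τ).re, (ω τ).im, z]

/-- The matrix `[Re e^{iθ}, -Im e^{iθ}, 0; Im e^{iθ}, Re e^{iθ}, 0; 0, 0, 1]`. -/
def zRotation (θ : ℝ) : Matrix (Fin 3) (Fin 3) ℝ :=
  !![Real.cos θ, -Real.sin θ, 0;
     Real.sin θ,  Real.cos θ, 0;
     0,           0,          1]

/-- `𝒯 ω = M`: the selective excitation transform of the pulse `ω` is the magnetization profile
`M`. For every frequency `z`, the solution of the Bloch equation that tends to `(0, 0, 1)` at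
`t = -∞` tends, in the rotating frame, to `M z` at `t = +∞`. -/
def IsSelectiveExcitation (ω : ℝ → ℂ) (M : ℝ → Fin 3 → ℝ) : Prop :=
  ∀ z : ℝ, ∃ m : ℝ → Fin 3 → ℝ,
    IsBlochSolution ω z m ∧
    Tendsto m atBot (𝓝 ![0, 0, 1]) ∧
    Tendsto (fun t : ℝ => zRotation (z * t) *ᵥ m t) atTop (𝓝 (M z))

/-- `ω` has rephasing time `ρ`: it vanishes (almost everywhere) after the time `ρ`. -/
def HasRephasingTime (ω : ℝ → ℂ) (ρ : ℝ) : Prop :=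
  ∀ᵐ t : ℝ, ρ < t → ω t = 0

/-- The reflection coefficient `r(ξ) = (M_x(2ξ) - i M_y(2ξ)) / (1 + M_z(2ξ))` of a magnetization
profile `M` that avoids the south pole. -/
def reflectionCoefficient (M : ℝ → Fin 3 → ℝ) (ξ : ℝ) : ℂ :=
  ((M (2 * ξ) 0 : ℂ) - Complex.I * (M (2 * ξ) 1 : ℂ)) / (1 + (M (2 * ξ) 2 : ℂ))

/-- `g` is a weak derivative of `f` on the real line. -/
def HasWeakDeriv (f g : ℝ → ℂ) : Prop :=
  ∀ φ : ℝ → ℂ, ContDiff ℝ ((⊤ : ℕ∞) : WithTop ℕ∞) φ → HasCompactSupport φ →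
    (∫ x, f x * deriv φ x) + (∫ x, g x * φ x) = 0

/-- `f` is in the Sobolev space `H¹(ℝ)`. -/
def MemH1 (f : ℝ → ℂ) : Prop :=
  MemLp f 2 volume ∧ ∃ g : ℝ → ℂ, MemLp g 2 volume ∧ HasWeakDeriv f g

/-- `R` is a meromorphic extension of `f : ℝ → ℂ` to the open upper half plane: it is meromorphic
there and has the boundary values `f` on the real line. -/
def IsMeromorphicExtension (f : ℝ → ℂ) (R : ℂ → ℂ) : Prop :=
  MeromorphicOn R {z : ℂ | 0 < z.im} ∧
    ∀ x : ℝ, Tendsto R (𝓝[{z : ℂ | 0 < z.im}] (x : ℂ)) (𝓝 (f x))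

/-- `R(z)` tends to zero as `|z| → ∞` in the upper half plane. -/
def VanishesAtInfinityUpper (R : ℂ → ℂ) : Prop :=
  Tendsto R (Bornology.cobounded ℂ ⊓ 𝓟 {z : ℂ | 0 < z.im}) (𝓝 0)

/-- `p 0, …, p (m - 1)` are the poles of `R` in the open upper half plane, listed without
repetition, and `d 0, …, d (m - 1)` are their multiplicities. -/
def ArePolesUpper (R : ℂ → ℂ) {m : ℕ} (p : Fin m → ℂ) (d : Fin m → ℕ) : Prop :=
  Function.Injective p ∧
    (∀ z : ℂ, z ∈ Set.range p ↔ 0 < z.im ∧ meromorphicOrderAt R z < 0) ∧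
    ∀ k : Fin m, meromorphicOrderAt R (p k) = ((-(d k : ℤ) : ℤ) : WithTop ℤ)

end

/-! The Bloch equation at frequency z = 2ξ is the quadratic image of a 2×2 linear system. With q =
-(i/2)ω, let (X, Y) solve X' = qY, Y' = -q̄X + 2iξY with (X, Y) → (1, 0) at -∞. Then m₁ + i m₂ = 2XȲ
and m₃ = |X|² - |Y|² (`bloch_eq_jost`). After the rephasing time ρ, X is constant and Y only
rotates. So r₀ = B/A on the real line, where A(ξ) = X(ρ) and B(ξ) = Y(ρ)
(`reflectionCoefficient_eq`).

A Neumann series shows that A and B are holomorphic in the upper half plane, continuous up to the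
real line, and tend to 1 and 0 at infinity. A holomorphic function with zero boundary values
vanishes, so the meromorphic extension of r₀ is B/A throughout (`eventually_mul_eq_of_boundary`). X
and Y never vanish together, so the poles of the extension are the zeros of A, with multiplicity. On
the real line |A|² + |B|² = 1, so log|A| = -½ log(1 + |r|²). The Poisson-Jensen formula
(`log_norm_eq_poisson_add_sum`) at iη, multiplied by -2η, then yields as η → ∞ η(1 - |A(iη)|²) → L =
(1/π) ∫ log(1 + |r|²) + 4 ∑ d_k Im ξ_k.

It remains to identify L with ∫|q|², which is a quarter of the energy. The basic identity is (|X|² +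
|Y|²)' = -4 Im ξ |Y|². For ∫|q|² ≤ L (`lintegral_sq_le_of_tendsto`): the identity bounds ∫|2ηY|² up
to ρ by η(1 - |A|²), while 2ηY = -q̄X - Y' converges to -q̄ after integration over bounded
intervals. This also proves that q is square integrable. For L ≤ ∫|q|²
(`mul_one_sub_norm_sq_jostX_le`): the evolution of |Y|² and Young's inequality give η(1 - |X|²) ≤
∫|q|² for every η > 0. -/

noncomputable section

/-! ### The Cayley transform and the Poisson formula on the half plane -/

/-- The Cayley map from the unit disc to the upper half plane that sends `0` to `i η`. -/
def cayley (η : ℝ) (w : ℂ) : ℂ := Complex.I * η * (1 + w) / (1 - w)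

lemma cayley_im (η : ℝ) (w : ℂ) :
    (cayley η w).im = η * (1 - ‖w‖ ^ 2) / Complex.normSq (1 - w) := by
  rw [cayley, Complex.div_im, ← Complex.normSq_eq_norm_sq, Complex.normSq_apply w]
  simp
  ring

lemma one_sub_ne_zero_of_norm_lt {w : ℂ} (hw : ‖w‖ < 1) : 1 - w ≠ 0 := by
  intro h
  rw [sub_eq_zero] at h
  simp [← h] at hw

lemma cayley_im_pos {η : ℝ} (hη : 0 < η) {w : ℂ} (hw : ‖w‖ < 1) : 0 < (cayley η w).im := by
  rw [cayley_im]
  have h1 := Complex.normSq_pos.2 (one_sub_ne_zero_of_norm_lt hw)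
  have h2 : 0 < 1 - ‖w‖ ^ 2 := by nlinarith [norm_nonneg w]
  positivity

lemma differentiableOn_cayley (η : ℝ) : DifferentiableOn ℂ (cayley η) (Metric.ball 0 1) := by
  intro w hw
  have := one_sub_ne_zero_of_norm_lt (mem_ball_zero_iff.1 hw)
  unfold cayley
  fun_prop (disch := exact this)

lemma tendsto_cayley_of_ne_one {η : ℝ} (hη : 0 < η) {w : ℂ} (hw : w ≠ 1) :
    Tendsto (cayley η) (𝓝[Metric.ball 0 1] w) (𝓝[{z : ℂ | 0 < z.im}] (cayley η w)) := by
  refine tendsto_nhdsWithin_iff.2 ⟨?_, ?_⟩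
  · have : ContinuousAt (cayley η) w := by
      have : 1 - w ≠ 0 := sub_ne_zero.2 hw.symm
      unfold cayley
      fun_prop (disch := exact this)
    exact this.tendsto.mono_left nhdsWithin_le_nhds
  · filter_upwards [self_mem_nhdsWithin] with u hu
    exact cayley_im_pos hη (mem_ball_zero_iff.1 hu)

/-- The boundary point 1 of the disc plays the role of infinity, so a limit at infinity becomes one
more boundary value. -/
lemma tendsto_cayley_one {η : ℝ} (hη : 0 < η) :
    Tendsto (cayley η) (𝓝[Metric.ball 0 1] 1)
      (Bornology.cobounded ℂ ⊓ 𝓟 {z : ℂ | 0 < z.im}) := by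
  refine tendsto_inf.2 ⟨?_, tendsto_principal.2 ?_⟩
  · rw [← tendsto_norm_atTop_iff_cobounded]
    have h1 : Tendsto (fun w : ℂ => ‖Complex.I * η * (1 + w)‖) (𝓝[Metric.ball 0 1] 1)
        (𝓝 (‖Complex.I * η * (1 + 1)‖)) := by
      refine Tendsto.mono_left ?_ nhdsWithin_le_nhds
      exact Continuous.tendsto (by fun_prop) 1
    have h2 : Tendsto (fun w : ℂ => ‖1 - w‖) (𝓝[Metric.ball 0 1] 1) (𝓝[>] 0) := by
      refine tendsto_nhdsWithin_iff.2 ⟨?_, ?_⟩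
      · refine Tendsto.mono_left ?_ nhdsWithin_le_nhds
        have : Continuous fun w : ℂ => ‖1 - w‖ := by fun_prop
        simpa using this.tendsto 1
      · filter_upwards [self_mem_nhdsWithin] with u hu
        exact norm_pos_iff.2 (one_sub_ne_zero_of_norm_lt (mem_ball_zero_iff.1 hu))
    have h3 := h1.pos_mul_atTop (by rw [norm_pos_iff]; norm_num; exact hη.ne') (tendsto_inv_nhdsGT_zero.comp h2)
    refine h3.congr fun w => ?_
    simp [cayley, div_eq_mul_inv]
  · filter_upwards [self_mem_nhdsWithin] with u hu
    exact cayley_im_pos hη (mem_ball_zero_iff.1 hu)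

/-- A holomorphic function on the upper half plane with continuous boundary values on the real
line and at infinity is transported to the closed unit disc by the Cayley map. -/
lemma exists_diffContOnCl_ball {F : ℂ → ℂ} {f : ℝ → ℂ} {c : ℂ}
    (hF : DifferentiableOn ℂ F {z : ℂ | 0 < z.im})
    (hb : ∀ x : ℝ, Tendsto F (𝓝[{z : ℂ | 0 < z.im}] (x : ℂ)) (𝓝 (f x)))
    (hc : Tendsto F (Bornology.cobounded ℂ ⊓ 𝓟 {z : ℂ | 0 < z.im}) (𝓝 c))
    {η : ℝ} (hη : 0 < η) :
    ∃ G : ℂ → ℂ, DiffContOnCl ℂ G (Metric.ball 0 1) ∧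
      (∀ w, ‖w‖ < 1 → G w = F (cayley η w)) ∧
      (∀ w, ‖w‖ = 1 → w ≠ 1 → G w = f (cayley η w).re) ∧ G 1 = c := by
  have hcl : closure (Metric.ball (0 : ℂ) 1) = Metric.closedBall 0 1 :=
    closure_ball _ one_ne_zero
  have hdiff : DifferentiableOn ℂ (F ∘ cayley η) (Metric.ball 0 1) :=
    hF.comp (differentiableOn_cayley η) fun w hw => cayley_im_pos hη (mem_ball_zero_iff.1 hw)
  have hsph : ∀ w : ℂ, ‖w‖ = 1 → w ≠ 1 →
      Tendsto (F ∘ cayley η) (𝓝[Metric.ball 0 1] w) (𝓝 (f (cayley η w).re)) := by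
    intro w hw h1
    have him : (((cayley η w).re : ℝ) : ℂ) = cayley η w := by
      apply Complex.ext <;> simp [cayley_im, hw]
    have h2 := tendsto_cayley_of_ne_one hη h1
    rw [← him] at h2
    exact (hb _).comp h2
  have hone : Tendsto (F ∘ cayley η) (𝓝[Metric.ball 0 1] 1) (𝓝 c) :=
    hc.comp (tendsto_cayley_one hη)
  have hball : ∀ w : ℂ, ‖w‖ < 1 →
      Tendsto (F ∘ cayley η) (𝓝[Metric.ball 0 1] w) (𝓝 (F (cayley η w))) := fun w hw =>
    (hdiff w (mem_ball_zero_iff.2 hw)).continuousWithinAt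
  have hmem : ∀ w : ℂ, ‖w‖ ≤ 1 → w ∈ closure (Metric.ball (0 : ℂ) 1) := fun w hw => by
    rw [hcl]; simpa using hw
  -- Since a limit exists at every point of the closed disc, the extension by limits is continuous
  -- there.
  have hval : ∀ w, ‖w‖ < 1 → extendFrom (Metric.ball 0 1) (F ∘ cayley η) w = F (cayley η w) :=
    fun w hw => extendFrom_eq (hmem w hw.le) (hball w hw)
  refine ⟨extendFrom (Metric.ball 0 1) (F ∘ cayley η), ⟨?_, ?_⟩, hval, ?_, ?_⟩
  · exact hdiff.congr fun w hw => hval w (mem_ball_zero_iff.1 hw)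
  · refine continuousOn_extendFrom subset_rfl fun w hw => ?_
    rw [hcl, mem_closedBall_zero_iff] at hw
    rcases hw.lt_or_eq with h | h
    · exact ⟨_, hball w h⟩
    · by_cases h1 : w = 1
      · exact ⟨c, h1 ▸ hone⟩
      · exact ⟨_, hsph w h h1⟩
  · exact fun w hw h1 => extendFrom_eq (hmem w hw.le) (hsph w hw h1)
  · exact extendFrom_eq (hmem 1 (by simp)) hone

/-- A holomorphic function on the upper half plane that vanishes on the real line and at infinity
is zero. -/
theorem eq_zero_of_tendsto_zero_boundary {F : ℂ → ℂ}
    (hF : DifferentiableOn ℂ F {z : ℂ | 0 < z.im})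
    (hb : ∀ x : ℝ, Tendsto F (𝓝[{z : ℂ | 0 < z.im}] (x : ℂ)) (𝓝 0))
    (hc : Tendsto F (Bornology.cobounded ℂ ⊓ 𝓟 {z : ℂ | 0 < z.im}) (𝓝 0))
    {z : ℂ} (hz : 0 < z.im) : F z = 0 := by
  obtain ⟨G, hG, hin, hsph, hone⟩ := exists_diffContOnCl_ball (f := fun _ => 0) hF hb hc one_pos
  have h0 : Set.EqOn G (fun _ => 0) (Metric.ball 0 1) := by
    refine Complex.eqOn_of_eqOn_frontier Metric.isBounded_ball hG diffContOnCl_const ?_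
    intro w hw
    rw [frontier_ball _ one_ne_zero, mem_sphere_zero_iff_norm] at hw
    by_cases h1 : w = 1
    · simp [h1, hone]
    · simp [hsph w hw h1]
  have hzI : z + Complex.I ≠ 0 := by
    intro h
    have := congrArg Complex.im h
    simp at this
    linarith
  have hw : ‖(z - Complex.I) / (z + Complex.I)‖ < 1 := by
    rw [norm_div, div_lt_one (norm_pos_iff.2 hzI)]
    refine lt_of_pow_lt_pow_left₀ 2 (norm_nonneg _) ?_
    rw [← Complex.normSq_eq_norm_sq, ← Complex.normSq_eq_norm_sq, Complex.normSq_apply,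
      Complex.normSq_apply]
    simp
    nlinarith
  have hcz : cayley 1 ((z - Complex.I) / (z + Complex.I)) = z := by
    have h2 : 1 - (z - Complex.I) / (z + Complex.I) ≠ 0 := one_sub_ne_zero_of_norm_lt hw
    rw [cayley, div_eq_iff h2]
    field_simp
    push_cast
    ring
  rw [← hcz, ← hin _ hw]
  exact h0 (mem_ball_zero_iff.2 hw)

/-- With α = arctan(x/η), the circle point is w = -e^{2iα}. Hence 1 - w = 2 cos α e^{iα} and 1 + w =
-2i sin α e^{iα}, so the Cayley image is η tan α. -/
lemma circleMap_two_arctan (x η : ℝ) (hη : 0 < η) :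
    circleMap 0 1 (2 * Real.arctan (x / η) + Real.pi) ≠ 1 ∧
      cayley η (circleMap 0 1 (2 * Real.arctan (x / η) + Real.pi)) = x := by
  set α := Real.arctan (x / η) with hα
  have hcos : 0 < Real.cos α := Real.cos_arctan_pos _
  have htan : Real.sin α = x / η * Real.cos α := by
    rw [← Real.tan_mul_cos hcos.ne', hα, Real.tan_arctan]
  have hmap : circleMap 0 1 (2 * α + Real.pi) =
      -(Complex.cos α + Complex.sin α * Complex.I) ^ 2 := by
    rw [circleMap, ← Complex.exp_mul_I, ← Complex.exp_nat_mul]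
    push_cast
    rw [add_mul, Complex.exp_add, Complex.exp_pi_mul_I]
    simp
    ring_nf
  have hne : (1 : ℂ) - circleMap 0 1 (2 * α + Real.pi) =
      2 * Complex.cos α * (Complex.cos α + Complex.sin α * Complex.I) := by
    rw [hmap]
    linear_combination -(Complex.sin_sq_add_cos_sq α) + (Complex.sin α) ^ 2 * Complex.I_sq
  have hcosC : (Complex.cos α) ≠ 0 := by
    rw [← Complex.ofReal_cos]; exact_mod_cast hcos.ne'
  have hu : Complex.cos α + Complex.sin α * Complex.I ≠ 0 := by
    rw [← Complex.exp_mul_I]; exact Complex.exp_ne_zero _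
  have hsub : (1 : ℂ) - circleMap 0 1 (2 * α + Real.pi) ≠ 0 := by
    rw [hne]; exact mul_ne_zero (mul_ne_zero two_ne_zero hcosC) hu
  refine ⟨fun h => hsub (by rw [h, sub_self]), ?_⟩
  have htanC : Complex.sin α = x / η * Complex.cos α := by
    rw [← Complex.ofReal_cos, ← Complex.ofReal_sin, htan]; push_cast; ring
  have hηC : (η : ℂ) ≠ 0 := by exact_mod_cast hη.ne'
  rw [cayley, div_eq_iff hsub, hne, hmap]
  have h1 : (1 : ℂ) + -(Complex.cos α + Complex.sin α * Complex.I) ^ 2 =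
      -2 * Complex.I * Complex.sin α * (Complex.cos α + Complex.sin α * Complex.I) := by
    linear_combination -(Complex.sin_sq_add_cos_sq α) - (Complex.sin α) ^ 2 * Complex.I_sq +
      2 * (Complex.sin α) ^ 2 * Complex.I_sq
  rw [h1, htanC]
  field_simp
  linear_combination (-((x : ℂ) * η) - Complex.I * x ^ 2) * Complex.I_sq

lemma image_two_arctan (η : ℝ) (hη : 0 < η) :
    (fun x : ℝ => 2 * Real.arctan (x / η) + Real.pi) '' Set.univ =
      Set.Ioo 0 (2 * Real.pi) := by
  ext θ
  constructor
  · rintro ⟨x, -, rfl⟩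
    have h1 := Real.neg_pi_div_two_lt_arctan (x / η)
    have h2 := Real.arctan_lt_pi_div_two (x / η)
    constructor <;> simp only <;> linarith
  · rintro ⟨h1, h2⟩
    refine ⟨η * Real.tan ((θ - Real.pi) / 2), trivial, ?_⟩
    simp only
    rw [mul_div_cancel_left₀ _ hη.ne', Real.arctan_tan (by linarith) (by linarith)]
    ring

/-- The circle average of a function, as a Poisson integral over the real line. -/
lemma circleAverage_eq_poisson (g : ℂ → ℝ) {η : ℝ} (hη : 0 < η) :
    Real.circleAverage g 0 1 = 1 / Real.pi * ∫ x : ℝ,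
      g (circleMap 0 1 (2 * Real.arctan (x / η) + Real.pi)) * (η / (x ^ 2 + η ^ 2)) := by
  -- The Jacobian of θ = 2 arctan(x/η) + π is twice the Poisson kernel up to π; it turns the factor
  -- 1/(2π) of the circle average into 1/π.
  have hder : ∀ x ∈ (Set.univ : Set ℝ), HasDerivWithinAt
      (fun x : ℝ => 2 * Real.arctan (x / η) + Real.pi) (2 * (η / (x ^ 2 + η ^ 2))) Set.univ x := by
    intro x _
    have h := (((hasDerivAt_id x).div_const η).arctan.const_mul 2).add_const Real.pi
    refine (h.congr_deriv ?_).hasDerivWithinAt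
    simp only [id]
    field_simp
    ring
  have hinj : Set.InjOn (fun x : ℝ => 2 * Real.arctan (x / η) + Real.pi) Set.univ := by
    intro x _ y _ h
    have h2 : Real.arctan (x / η) = Real.arctan (y / η) := by simpa using h
    have h3 := Real.arctan_injective h2
    field_simp at h3
    exact h3
  rw [Real.circleAverage, intervalIntegral.integral_of_le (by positivity),
    integral_Ioc_eq_integral_Ioo, ← image_two_arctan η hη,
    integral_image_eq_integral_abs_deriv_smul MeasurableSet.univ hder hinj, setIntegral_univ,
    smul_eq_mul, ← integral_const_mul, ← integral_const_mul]
  congr 1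
  ext x
  rw [abs_of_pos (by positivity), smul_eq_mul]
  field_simp

/-- The Poisson formula on the upper half plane for the logarithm of the modulus of a
nowhere vanishing function. -/
theorem log_norm_eq_poisson {F : ℂ → ℂ} {f : ℝ → ℂ} {c : ℂ}
    (hF : DifferentiableOn ℂ F {z : ℂ | 0 < z.im})
    (hb : ∀ x : ℝ, Tendsto F (𝓝[{z : ℂ | 0 < z.im}] (x : ℂ)) (𝓝 (f x)))
    (hc : Tendsto F (Bornology.cobounded ℂ ⊓ 𝓟 {z : ℂ | 0 < z.im}) (𝓝 c))
    (hF0 : ∀ z : ℂ, 0 < z.im → F z ≠ 0) (hf0 : ∀ x, f x ≠ 0) (hc0 : c ≠ 0)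
    {η : ℝ} (hη : 0 < η) :
    Real.log ‖F (Complex.I * η)‖ =
      1 / Real.pi * ∫ x : ℝ, Real.log ‖f x‖ * (η / (x ^ 2 + η ^ 2)) := by
  obtain ⟨G, hG, hin, hsph, hone⟩ := exists_diffContOnCl_ball hF hb hc hη
  have hG0 : ∀ w ∈ Metric.closedBall (0 : ℂ) 1, G w ≠ 0 := by
    intro w hw
    rcases (mem_closedBall_zero_iff.1 hw).lt_or_eq with h | h
    · rw [hin w h]; exact hF0 _ (cayley_im_pos hη h)
    · by_cases h1 : w = 1
      · rw [h1, hone]; exact hc0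
      · rw [hsph w h h1]; exact hf0 _
  -- Having no zeros on the closed disc, including the point at infinity, makes log|G| harmonic and
  -- continuous up to the circle, so the mean value property applies.
  have hharm : InnerProductSpace.HarmonicContOnCl (fun w => Real.log ‖G w‖)
      (Metric.ball 0 |(1 : ℝ)|) := by
    rw [abs_one]
    refine InnerProductSpace.HarmonicContOnCl.mk_ball ?_ ?_
    · intro w hw
      exact (hG.differentiableOn.analyticAt (Metric.isOpen_ball.mem_nhds hw)).harmonicAt_log_norm
        (hG0 w (Metric.ball_subset_closedBall hw))
    · exact (hG.continuousOn_ball.norm).log fun w hw => norm_ne_zero_iff.2 (hG0 w hw)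
  have key := hharm.circleAverage_eq
  rw [hin 0 (by simp), circleAverage_eq_poisson _ hη] at key
  have h0 : cayley η 0 = Complex.I * η := by simp [cayley]
  rw [h0] at key
  rw [← key]
  congr 2
  ext x
  obtain ⟨h1, h2⟩ := circleMap_two_arctan x η hη
  rw [hsph _ (by simp) h1, h2, Complex.ofReal_re]

/-! ### Meromorphic orders and removable singularities -/

lemma isOpen_im_pos : IsOpen {z : ℂ | 0 < z.im} := isOpen_lt continuous_const Complex.continuous_im

lemma meromorphicOrderAt_eq_zero_of_ne {f : ℂ → ℂ} {z : ℂ} (hf : AnalyticAt ℂ f z) (h : f z ≠ 0) :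
    meromorphicOrderAt f z = 0 :=
  (tendsto_ne_zero_iff_meromorphicOrderAt_eq_zero hf.meromorphicAt).1
    ⟨f z, h, hf.continuousAt.tendsto.mono_left nhdsWithin_le_nhds⟩

lemma meromorphicOrderAt_pos_iff_eq_zero {f : ℂ → ℂ} {z : ℂ} (hf : AnalyticAt ℂ f z) :
    0 < meromorphicOrderAt f z ↔ f z = 0 := by
  constructor
  · intro h
    by_contra h0
    exact h.ne' (meromorphicOrderAt_eq_zero_of_ne hf h0)
  · intro h
    rw [← tendsto_zero_iff_meromorphicOrderAt_pos hf.meromorphicAt, ← h]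
    exact hf.continuousAt.tendsto.mono_left nhdsWithin_le_nhds

/-- A meromorphic function without poles agrees, up to isolated points, with a holomorphic one. -/
lemma exists_differentiableOn_of_meromorphicOrderAt_nonneg {f : ℂ → ℂ} {U : Set ℂ}
    (hf : MeromorphicOn f U) (h0 : ∀ z ∈ U, 0 ≤ meromorphicOrderAt f z) :
    ∃ g : ℂ → ℂ, DifferentiableOn ℂ g U ∧ (∀ z ∈ U, g =ᶠ[𝓝[≠] z] f) ∧
      ∀ z ∈ U, meromorphicOrderAt f z = 0 → g z ≠ 0 := by
  have hNF := meromorphicNFOn_toMeromorphicNFOn f U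
  refine ⟨toMeromorphicNFOn f U, fun z hz => ?_, fun z hz =>
    hf.toMeromorphicNFOn_eq_self_on_nhdsNE hz, fun z hz hz0 => ?_⟩
  · refine AnalyticAt.differentiableWithinAt ?_
    rw [← (hNF hz).meromorphicOrderAt_nonneg_iff_analyticAt,
      meromorphicOrderAt_toMeromorphicNFOn hf hz]
    exact h0 z hz
  · rwa [← (hNF hz).meromorphicOrderAt_eq_zero_iff, meromorphicOrderAt_toMeromorphicNFOn hf hz]

/-- Limits at the boundary are insensitive to a change at isolated points. -/
lemma tendsto_inf_principal_of_eventuallyEq {f g : ℂ → ℂ} {U : Set ℂ} (hU : IsOpen U)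
    {l : Filter ℂ} (hl : ∀ s ∈ l, ∃ u ∈ l, IsOpen u ∧ u ⊆ s) (hg : ContinuousOn g U)
    (hfg : ∀ z ∈ U, g =ᶠ[𝓝[≠] z] f) {c : ℂ} (hf : Tendsto f (l ⊓ 𝓟 U) (𝓝 c)) :
    Tendsto g (l ⊓ 𝓟 U) (𝓝 c) := by
  refine (closed_nhds_basis c).tendsto_right_iff.2 fun V ⟨hV, hVc⟩ => ?_
  obtain ⟨u, hu, huo, hus⟩ := hl _ (mem_inf_principal.1 (hf hV))
  -- At z in u ∩ U, the value g z is a limit of values of f at nearby points of u ∩ U. These lie in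
  -- V, and V is closed.
  refine mem_inf_principal.2 (mem_of_superset hu fun z hz hzU => ?_)
  have hcont : Tendsto g (𝓝[≠] z) (𝓝 (g z)) :=
    (hg.continuousAt (hU.mem_nhds hzU)).tendsto.mono_left nhdsWithin_le_nhds
  refine hVc.mem_of_tendsto hcont ?_
  have h1 : ∀ᶠ w in 𝓝[≠] z, w ∈ u ∩ U :=
    nhdsWithin_le_nhds ((huo.inter hU).mem_nhds ⟨hz, hzU⟩)
  filter_upwards [h1, hfg z hzU] with w hw hgw
  rw [hgw]
  exact hus hw.1 hw.2

lemma exists_isOpen_subset_of_mem_nhds (x : ℂ) : ∀ s ∈ 𝓝 x, ∃ u ∈ 𝓝 x, IsOpen u ∧ u ⊆ s :=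
  fun s hs => ⟨interior s, interior_mem_nhds.2 hs, isOpen_interior, interior_subset⟩

lemma exists_isOpen_subset_of_mem_cobounded :
    ∀ s ∈ Bornology.cobounded ℂ, ∃ u ∈ Bornology.cobounded ℂ, IsOpen u ∧ u ⊆ s := by
  intro s hs
  obtain ⟨r, -, hr⟩ := (Metric.hasBasis_cobounded_compl_closedBall (0 : ℂ)).mem_iff.1 hs
  exact ⟨_, (Metric.hasBasis_cobounded_compl_closedBall (0 : ℂ)).mem_of_mem trivial,
    Metric.isClosed_closedBall.isOpen_compl, hr⟩

/-! ### Blaschke products and the Poisson-Jensen formula -/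

/-- The finite Blaschke product with zeros `p k` of orders `d k` in the upper half plane. -/
def halfPlaneBlaschke {m : ℕ} (p : Fin m → ℂ) (d : Fin m → ℕ) (z : ℂ) : ℂ :=
  ∏ k, ((z - p k) / (z - (starRingEnd ℂ) (p k))) ^ d k

section Blaschke
variable {m : ℕ} {p : Fin m → ℂ} {d : Fin m → ℕ}

lemma sub_conj_ne_zero {z w : ℂ} (hz : 0 ≤ z.im) (hw : 0 < w.im) :
    z - (starRingEnd ℂ) w ≠ 0 := by
  intro h
  have := congrArg Complex.im h
  simp at this
  linarith

lemma analyticAt_halfPlaneBlaschke (hp : ∀ k, 0 < (p k).im) {z : ℂ} (hz : 0 ≤ z.im) :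
    AnalyticAt ℂ (halfPlaneBlaschke p d) z := by
  unfold halfPlaneBlaschke
  refine Finset.analyticAt_fun_prod _ fun k _ => ?_
  have := sub_conj_ne_zero hz (hp k)
  fun_prop (disch := exact this)

lemma halfPlaneBlaschke_ne_zero (hp : ∀ k, 0 < (p k).im) {z : ℂ} (hz : 0 ≤ z.im)
    (hzp : z ∉ Set.range p) : halfPlaneBlaschke p d z ≠ 0 := by
  refine Finset.prod_ne_zero_iff.2 fun k _ => pow_ne_zero _ (div_ne_zero ?_ ?_)
  · exact sub_ne_zero.2 fun h => hzp ⟨k, h.symm⟩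
  · exact sub_conj_ne_zero hz (hp k)

/-- A real point is equidistant from `p k` and its conjugate. -/
lemma norm_halfPlaneBlaschke_ofReal (hp : ∀ k, 0 < (p k).im) (x : ℝ) :
    ‖halfPlaneBlaschke p d x‖ = 1 := by
  rw [halfPlaneBlaschke, norm_prod]
  refine Finset.prod_eq_one fun k _ => ?_
  have h : ‖(x : ℂ) - p k‖ = ‖(x : ℂ) - (starRingEnd ℂ) (p k)‖ := by
    rw [← Complex.norm_conj ((x : ℂ) - p k)]
    simp
  have h0 : ‖(x : ℂ) - (starRingEnd ℂ) (p k)‖ ≠ 0 :=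
    norm_ne_zero_iff.2 (sub_conj_ne_zero (by simp) (hp k))
  rw [norm_pow, norm_div, h, div_self h0, one_pow]

lemma tendsto_halfPlaneBlaschke_cobounded :
    Tendsto (halfPlaneBlaschke p d) (Bornology.cobounded ℂ) (𝓝 1) := by
  have h1 : ∀ c : ℂ, Tendsto (fun z : ℂ => z - c) (Bornology.cobounded ℂ)
      (Bornology.cobounded ℂ) := fun c => by
    simp [sub_eq_add_neg, tendsto_add_const_cobounded (-c)]
  have h : ∀ k ∈ (Finset.univ : Finset (Fin m)), Tendsto
      (fun z : ℂ => ((z - p k) / (z - (starRingEnd ℂ) (p k))) ^ d k)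
      (Bornology.cobounded ℂ) (𝓝 (1 ^ d k)) := by
    intro k _
    refine Tendsto.pow ?_ _
    have h2 : Tendsto (fun z : ℂ => 1 + ((starRingEnd ℂ) (p k) - p k) *
        (z - (starRingEnd ℂ) (p k))⁻¹) (Bornology.cobounded ℂ) (𝓝 (1 + _ * 0)) :=
      tendsto_const_nhds.add (tendsto_const_nhds.mul (tendsto_inv₀_cobounded.comp (h1 _)))
    rw [mul_zero, add_zero] at h2
    refine h2.congr' ?_
    have h3 : ∀ᶠ z : ℂ in Bornology.cobounded ℂ, z - (starRingEnd ℂ) (p k) ≠ 0 :=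
      (h1 _).eventually (Bornology.eventually_ne_cobounded 0)
    filter_upwards [h3] with z hz
    field_simp
    ring
  have h4 := tendsto_finsetProd _ h
  simp only [one_pow, Finset.prod_const_one] at h4
  exact h4

lemma meromorphicOrderAt_halfPlaneBlaschke (hp : ∀ k, 0 < (p k).im) (hinj : Function.Injective p)
    (k : Fin m) : meromorphicOrderAt (halfPlaneBlaschke p d) (p k) = ((d k : ℤ) : WithTop ℤ) := by
  have hne := fun j => sub_conj_ne_zero (hp k).le (hp j)
  rw [meromorphicOrderAt_eq_int_iff (analyticAt_halfPlaneBlaschke hp (hp k).le).meromorphicAt]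
  -- The witness is the product with the factor (z - p k)^(d k) removed; it does not vanish at `p k`
  -- because the zeros are distinct.
  refine ⟨fun z => ((z - (starRingEnd ℂ) (p k)) ^ d k)⁻¹ *
    ∏ j ∈ Finset.univ.erase k, ((z - p j) / (z - (starRingEnd ℂ) (p j))) ^ d j, ?_, ?_, ?_⟩
  · refine AnalyticAt.mul ?_ (Finset.analyticAt_fun_prod _ fun j _ => ?_)
    · have := pow_ne_zero (d k) (hne k)
      fun_prop (disch := exact this)
    · have := hne j
      fun_prop (disch := exact this)
  · refine mul_ne_zero (inv_ne_zero (pow_ne_zero _ (hne k)))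
      (Finset.prod_ne_zero_iff.2 fun j hj => pow_ne_zero _ (div_ne_zero ?_ (hne j)))
    exact sub_ne_zero.2 fun h => (Finset.ne_of_mem_erase hj) (hinj h.symm)
  · refine Eventually.of_forall fun z => ?_
    rw [halfPlaneBlaschke, ← Finset.mul_prod_erase _ _ (Finset.mem_univ k), zpow_natCast, div_pow,
      smul_eq_mul]
    ring

lemma log_norm_halfPlaneBlaschke (hp : ∀ k, 0 < (p k).im) {z : ℂ} (hz : 0 ≤ z.im)
    (hzp : z ∉ Set.range p) : Real.log ‖halfPlaneBlaschke p d z‖ =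
      ∑ k, (d k : ℝ) * Real.log ‖(z - p k) / (z - (starRingEnd ℂ) (p k))‖ := by
  rw [halfPlaneBlaschke, norm_prod, Real.log_prod]
  · exact Finset.sum_congr rfl fun k _ => by rw [norm_pow, Real.log_pow]
  · intro k _
    refine norm_ne_zero_iff.2 (pow_ne_zero _ (div_ne_zero ?_ ?_))
    · exact sub_ne_zero.2 fun h => hzp ⟨k, h.symm⟩
    · exact sub_conj_ne_zero hz (hp k)

end Blaschke

/-- The Poisson-Jensen formula on the upper half plane, for a function with finitely many zeros. -/
theorem log_norm_eq_poisson_add_sum {A : ℂ → ℂ} {a : ℝ → ℂ} {c : ℂ}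
    (hA : DifferentiableOn ℂ A {z : ℂ | 0 < z.im})
    (hb : ∀ x : ℝ, Tendsto A (𝓝[{z : ℂ | 0 < z.im}] (x : ℂ)) (𝓝 (a x)))
    (hc : Tendsto A (Bornology.cobounded ℂ ⊓ 𝓟 {z : ℂ | 0 < z.im}) (𝓝 c))
    (ha0 : ∀ x, a x ≠ 0) (hc0 : c ≠ 0)
    {m : ℕ} {p : Fin m → ℂ} {d : Fin m → ℕ} (hinj : Function.Injective p)
    (hp : ∀ k, 0 < (p k).im) (hord : ∀ k, meromorphicOrderAt A (p k) = ((d k : ℤ) : WithTop ℤ))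
    (hA0 : ∀ z : ℂ, 0 < z.im → z ∉ Set.range p → A z ≠ 0)
    {η : ℝ} (hη : 0 < η) (hηp : Complex.I * η ∉ Set.range p) :
    Real.log ‖A (Complex.I * η)‖ =
      1 / Real.pi * (∫ x : ℝ, Real.log ‖a x‖ * (η / (x ^ 2 + η ^ 2))) +
        ∑ k, (d k : ℝ) * Real.log
          ‖(Complex.I * η - p k) / (Complex.I * η - (starRingEnd ℂ) (p k))‖ := by
  set B := halfPlaneBlaschke p d with hB
  have hηim : 0 < (Complex.I * η : ℂ).im := by simpa using hη
  have hAan : ∀ z : ℂ, 0 < z.im → AnalyticAt ℂ A z := fun z hz =>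
    hA.analyticAt (isOpen_im_pos.mem_nhds hz)
  have hBan : ∀ z : ℂ, 0 ≤ z.im → AnalyticAt ℂ B z := fun z hz =>
    analyticAt_halfPlaneBlaschke hp hz
  -- Dividing by the Blaschke product removes all zeros of A and changes neither the modulus on the
  -- real line nor the limit at infinity.
  have hmer : ∀ z : ℂ, 0 < z.im → MeromorphicAt (fun z => A z * (B z)⁻¹) z := fun z hz =>
    (hAan z hz).meromorphicAt.fun_mul (hBan z hz.le).meromorphicAt.fun_inv
  have hord0 : ∀ z : ℂ, 0 < z.im → meromorphicOrderAt (fun z => A z * (B z)⁻¹) z = 0 := by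
    intro z hz
    by_cases hzp : z ∈ Set.range p
    · obtain ⟨k, rfl⟩ := hzp
      rw [fun_meromorphicOrderAt_mul (hAan _ hz).meromorphicAt
        (hBan _ hz.le).meromorphicAt.fun_inv, fun_meromorphicOrderAt_inv, hord k, hB,
        meromorphicOrderAt_halfPlaneBlaschke hp hinj k]
      norm_cast
      simp
    · have hBz := halfPlaneBlaschke_ne_zero (d := d) hp hz.le hzp
      exact meromorphicOrderAt_eq_zero_of_ne ((hAan z hz).fun_mul ((hBan z hz.le).fun_inv hBz))
        (mul_ne_zero (hA0 z hz hzp) (inv_ne_zero hBz))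
  obtain ⟨F, hF, hFe, hF0⟩ := exists_differentiableOn_of_meromorphicOrderAt_nonneg
    (U := {z : ℂ | 0 < z.im}) hmer fun z hz => (hord0 z hz).ge
  have hBx : ∀ x : ℝ, B x ≠ 0 := fun x => by
    rw [← norm_ne_zero_iff, hB, norm_halfPlaneBlaschke_ofReal hp]; exact one_ne_zero
  have hFb : ∀ x : ℝ, Tendsto F (𝓝[{z : ℂ | 0 < z.im}] (x : ℂ)) (𝓝 (a x * (B x)⁻¹)) := by
    intro x
    refine tendsto_inf_principal_of_eventuallyEq isOpen_im_pos (exists_isOpen_subset_of_mem_nhds _)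
      hF.continuousOn hFe ((hb x).mul (Tendsto.inv₀ ?_ (hBx x)))
    exact (hBan x (by simp)).continuousAt.tendsto.mono_left nhdsWithin_le_nhds
  have hFc : Tendsto F (Bornology.cobounded ℂ ⊓ 𝓟 {z : ℂ | 0 < z.im}) (𝓝 (c * 1⁻¹)) := by
    refine tendsto_inf_principal_of_eventuallyEq isOpen_im_pos
      exists_isOpen_subset_of_mem_cobounded hF.continuousOn hFe
      (hc.mul (Tendsto.inv₀ ?_ one_ne_zero))
    exact tendsto_halfPlaneBlaschke_cobounded.mono_left inf_le_left
  have key := log_norm_eq_poisson hF hFb hFc (fun z hz => hF0 z hz (hord0 z hz))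
    (fun x => mul_ne_zero (ha0 x) (inv_ne_zero (hBx x))) (by simpa using hc0) hη
  have hBη := halfPlaneBlaschke_ne_zero (d := d) hp hηim.le hηp
  -- F and A/B are only known to agree near iη with iη itself left out; both are continuous there,
  -- so the values agree too.
  have hFη : F (Complex.I * η) = A (Complex.I * η) * (B (Complex.I * η))⁻¹ := by
    refine tendsto_nhds_unique_of_eventuallyEq
      (l := 𝓝[≠] (Complex.I * η)) ?_ ?_ (hFe _ hηim)
    · exact (hF.continuousOn.continuousAt (isOpen_im_pos.mem_nhds hηim)).tendsto.mono_left
        nhdsWithin_le_nhds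
    · exact ((hAan _ hηim).fun_mul ((hBan _ hηim.le).fun_inv hBη)).continuousAt.tendsto.mono_left
        nhdsWithin_le_nhds
  have hAη := hA0 _ hηim hηp
  rw [hFη, norm_mul, norm_inv, Real.log_mul (norm_ne_zero_iff.2 hAη)
    (inv_ne_zero (norm_ne_zero_iff.2 hBη)), Real.log_inv, hB,
    log_norm_halfPlaneBlaschke hp hηim.le hηp] at key
  have hint : ∀ x : ℝ, ‖a x * (B x)⁻¹‖ = ‖a x‖ := fun x => by
    rw [norm_mul, norm_inv, hB, norm_halfPlaneBlaschke_ofReal hp, inv_one, mul_one]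
  simp only [← hB, hint] at key
  linarith

/-! ### Identification of a quotient from its boundary values -/

/-- A meromorphic function whose boundary values are the quotient of those of two holomorphic
functions is the quotient of the two functions. -/
theorem eventually_mul_eq_of_boundary {R A B : ℂ → ℂ} {r a : ℝ → ℂ} {c : ℂ}
    (hR : IsMeromorphicExtension r R) (hRlim : VanishesAtInfinityUpper R)
    {m : ℕ} {p : Fin m → ℂ} {d : Fin m → ℕ} (hpoles : ArePolesUpper R p d)
    (hA : DifferentiableOn ℂ A {z : ℂ | 0 < z.im})
    (hAb : ∀ x : ℝ, Tendsto A (𝓝[{z : ℂ | 0 < z.im}] (x : ℂ)) (𝓝 (a x)))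
    (hAc : Tendsto A (Bornology.cobounded ℂ ⊓ 𝓟 {z : ℂ | 0 < z.im}) (𝓝 c))
    (hB : DifferentiableOn ℂ B {z : ℂ | 0 < z.im})
    (hBb : ∀ x : ℝ, Tendsto B (𝓝[{z : ℂ | 0 < z.im}] (x : ℂ)) (𝓝 (r x * a x)))
    (hBc : Tendsto B (Bornology.cobounded ℂ ⊓ 𝓟 {z : ℂ | 0 < z.im}) (𝓝 0))
    {z : ℂ} (hz : 0 < z.im) : ∀ᶠ w in 𝓝[≠] z, R w * A w = B w := by
  obtain ⟨hinj, hiff, hord⟩ := hpoles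
  have hp : ∀ k, 0 < (p k).im := fun k => ((hiff _).1 ⟨k, rfl⟩).1
  have hAan : ∀ z : ℂ, 0 < z.im → AnalyticAt ℂ A z := fun z hz =>
    hA.analyticAt (isOpen_im_pos.mem_nhds hz)
  have hBan : ∀ z : ℂ, 0 < z.im → AnalyticAt ℂ B z := fun z hz =>
    hB.analyticAt (isOpen_im_pos.mem_nhds hz)
  set P := halfPlaneBlaschke p d with hP
  have hPan : ∀ z : ℂ, 0 ≤ z.im → AnalyticAt ℂ P z := fun z hz =>
    analyticAt_halfPlaneBlaschke hp hz
  have hRA : ∀ z : ℂ, 0 < z.im → MeromorphicAt (fun z => R z * A z) z := fun z hz =>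
    (hR.1 z hz).fun_mul (hAan z hz).meromorphicAt
  have hD : ∀ z : ℂ, 0 < z.im → MeromorphicAt (fun z => R z * A z - B z) z := fun z hz =>
    (hRA z hz).fun_sub (hBan z hz).meromorphicAt
  -- RA - B has boundary values 0 but possibly the poles of R. The Blaschke factor P clears these
  -- poles and keeps the zero limits on the real line and at infinity.
  have hmer : ∀ z : ℂ, 0 < z.im → MeromorphicAt (fun z => (R z * A z - B z) * P z) z :=
    fun z hz => (hD z hz).fun_mul (hPan z hz.le).meromorphicAt
  have hmin : ∀ z : ℂ, 0 < z.im → min (meromorphicOrderAt R z) 0 ≤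
      meromorphicOrderAt (fun z => R z * A z - B z) z := by
    intro z hz
    have h1 := meromorphicOrderAt_add (hRA z hz) (hBan z hz).meromorphicAt.neg
    rw [fun_meromorphicOrderAt_mul (hR.1 z hz) (hAan z hz).meromorphicAt,
      ← meromorphicOrderAt_neg (f := B)] at h1
    have h2 : (fun z => R z * A z - B z) = (fun z => R z * A z) + -B := by
      ext w; simp [sub_eq_add_neg]
    rw [h2]
    refine le_trans (min_le_min ?_ (hBan z hz).meromorphicOrderAt_nonneg) h1
    exact le_add_of_nonneg_right (hAan z hz).meromorphicOrderAt_nonneg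
  have hnonneg : ∀ z ∈ {z : ℂ | 0 < z.im},
      0 ≤ meromorphicOrderAt (fun z => (R z * A z - B z) * P z) z := by
    intro z hz
    rw [fun_meromorphicOrderAt_mul (hD z hz) (hPan z (le_of_lt hz)).meromorphicAt]
    by_cases hzp : z ∈ Set.range p
    · obtain ⟨k, rfl⟩ := hzp
      have h1 := hmin _ (hp k)
      rw [hord k, min_eq_left (by norm_cast; omega)] at h1
      rw [hP, meromorphicOrderAt_halfPlaneBlaschke hp hinj k]
      refine le_trans ?_ (add_le_add_left h1 _)
      norm_cast
      simp
    · have h1 := hmin z hz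
      have h2 : 0 ≤ meromorphicOrderAt R z := by
        by_contra h
        exact hzp ((hiff z).2 ⟨hz, not_le.1 h⟩)
      rw [min_eq_right h2] at h1
      exact add_nonneg h1 (hPan z (le_of_lt hz)).meromorphicOrderAt_nonneg
  obtain ⟨F, hF, hFe, -⟩ := exists_differentiableOn_of_meromorphicOrderAt_nonneg
    (U := {z : ℂ | 0 < z.im}) hmer hnonneg
  have hFb : ∀ x : ℝ, Tendsto F (𝓝[{z : ℂ | 0 < z.im}] (x : ℂ)) (𝓝 0) := by
    intro x
    refine tendsto_inf_principal_of_eventuallyEq isOpen_im_pos (exists_isOpen_subset_of_mem_nhds _)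
      hF.continuousOn hFe ?_
    have h1 : Tendsto P (𝓝[{z : ℂ | 0 < z.im}] (x : ℂ)) (𝓝 (P x)) :=
      (hPan x (by simp)).continuousAt.tendsto.mono_left nhdsWithin_le_nhds
    have h2 := (((hR.2 x).mul (hAb x)).sub (hBb x)).mul h1
    rw [sub_self, zero_mul] at h2
    exact h2
  have hFc : Tendsto F (Bornology.cobounded ℂ ⊓ 𝓟 {z : ℂ | 0 < z.im}) (𝓝 0) := by
    refine tendsto_inf_principal_of_eventuallyEq isOpen_im_pos
      exists_isOpen_subset_of_mem_cobounded hF.continuousOn hFe ?_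
    have h1 : Tendsto P (Bornology.cobounded ℂ ⊓ 𝓟 {z : ℂ | 0 < z.im}) (𝓝 1) :=
      tendsto_halfPlaneBlaschke_cobounded.mono_left inf_le_left
    simpa using ((Tendsto.mul hRlim hAc).sub hBc).mul h1
  have hFz : ∀ᶠ w in 𝓝[≠] z, 0 < w.im := nhdsWithin_le_nhds (isOpen_im_pos.mem_nhds hz)
  have hPz : ∀ᶠ w in 𝓝[≠] z, P w ≠ 0 := by
    rw [← meromorphicOrderAt_ne_top_iff_eventually_ne_zero (hPan z hz.le).meromorphicAt]
    by_cases hzp : z ∈ Set.range p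
    · obtain ⟨k, rfl⟩ := hzp
      rw [hP, meromorphicOrderAt_halfPlaneBlaschke hp hinj k]
      exact WithTop.coe_ne_top
    · rw [meromorphicOrderAt_eq_zero_of_ne (hPan z hz.le)
        (halfPlaneBlaschke_ne_zero hp hz.le hzp)]
      exact WithTop.zero_ne_top
  filter_upwards [hFe z hz, hFz, hPz] with w h1 h2 h3
  rw [eq_zero_of_tendsto_zero_boundary hF hFb hFc h2] at h1
  exact sub_eq_zero.1 ((mul_eq_zero.1 h1.symm).resolve_right h3)

/-- The poles of a quotient of two holomorphic functions without common zeros are the zeros of the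
denominator. -/
theorem zeros_of_eventually_mul_eq {R A B : ℂ → ℂ} (hR : MeromorphicOn R {z : ℂ | 0 < z.im})
    {m : ℕ} {p : Fin m → ℂ} {d : Fin m → ℕ} (hpoles : ArePolesUpper R p d)
    (hA : DifferentiableOn ℂ A {z : ℂ | 0 < z.im}) (hB : DifferentiableOn ℂ B {z : ℂ | 0 < z.im})
    (hAB : ∀ z : ℂ, 0 < z.im → A z = 0 → B z ≠ 0)
    (h : ∀ z : ℂ, 0 < z.im → ∀ᶠ w in 𝓝[≠] z, R w * A w = B w) :
    (∀ k, meromorphicOrderAt A (p k) = ((d k : ℤ) : WithTop ℤ)) ∧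
      ∀ z : ℂ, 0 < z.im → z ∉ Set.range p → A z ≠ 0 := by
  obtain ⟨hinj, hiff, hord⟩ := hpoles
  have hAan : ∀ z : ℂ, 0 < z.im → AnalyticAt ℂ A z := fun z hz =>
    hA.analyticAt (isOpen_im_pos.mem_nhds hz)
  have hBan : ∀ z : ℂ, 0 < z.im → AnalyticAt ℂ B z := fun z hz =>
    hB.analyticAt (isOpen_im_pos.mem_nhds hz)
  have hadd : ∀ z : ℂ, 0 < z.im →
      meromorphicOrderAt R z + meromorphicOrderAt A z = meromorphicOrderAt B z := by
    intro z hz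
    rw [← meromorphicOrderAt_mul (hR z hz) (hAan z hz).meromorphicAt]
    exact meromorphicOrderAt_congr (h z hz)
  constructor
  · intro k
    obtain ⟨hk, hneg⟩ := (hiff _).1 ⟨k, rfl⟩
    have h1 := hadd _ hk
    -- If A did not vanish here, B would inherit the pole of R. So A vanishes, B does not, and ord R
    -- + ord A = 0.
    have hA0 : A (p k) = 0 := by
      by_contra h0
      rw [meromorphicOrderAt_eq_zero_of_ne (hAan _ hk) h0, add_zero] at h1
      exact absurd (hBan _ hk).meromorphicOrderAt_nonneg (by rw [← h1]; exact not_le.2 hneg)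
    rw [hord k, meromorphicOrderAt_eq_zero_of_ne (hBan _ hk) (hAB _ hk hA0)] at h1
    generalize meromorphicOrderAt A (p k) = y at h1 ⊢
    cases y with
    | top => simp at h1
    | coe y =>
      norm_cast at h1 ⊢
      omega
  · intro z hz hzp hA0
    -- A zero of A away from the poles would give ord R ≥ 0, ord A > 0 and ord B = 0, against
    -- additivity of orders.
    have h1 := hadd z hz
    rw [meromorphicOrderAt_eq_zero_of_ne (hBan _ hz) (hAB _ hz hA0)] at h1
    have h2 : 0 ≤ meromorphicOrderAt R z := by
      by_contra h
      exact hzp ((hiff z).2 ⟨hz, not_le.1 h⟩)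
    have h3 := (meromorphicOrderAt_pos_iff_eq_zero (hAan z hz)).2 hA0
    exact absurd h1 (h3.trans_le (le_add_of_nonneg_left h2)).ne'

/-! ### Calculus of absolutely continuous functions -/

/-- The product rule for absolutely continuous real functions, in integrated form. -/
lemma mul_sub_mul_eq_integral_real {F G f g : ℝ → ℝ}
    (hf : ∀ a b, IntervalIntegrable f volume a b) (hg : ∀ a b, IntervalIntegrable g volume a b)
    (hF : ∀ a b, F b - F a = ∫ t in a..b, f t) (hG : ∀ a b, G b - G a = ∫ t in a..b, g t)
    (a b : ℝ) : F b * G b - F a * G a = ∫ t in a..b, (f t * G t + F t * g t) := by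
  have hac : ∀ {h H : ℝ → ℝ}, (∀ a b, IntervalIntegrable h volume a b) →
      (∀ a b, H b - H a = ∫ t in a..b, h t) → AbsolutelyContinuousOnInterval H a b := by
    intro h H hh hH
    have h1 : H = fun x => (∫ t in a..x, h t) + H a := by
      ext x; rw [← hH a x]; ring
    rw [h1]
    refine ((hh a b).absolutelyContinuousOnInterval_intervalIntegral Set.left_mem_uIcc).fun_add ?_
    exact (LipschitzWith.const (H a)).lipschitzOnWith.absolutelyContinuousOnInterval
  have hderiv : ∀ {h H : ℝ → ℝ}, (∀ a b, IntervalIntegrable h volume a b) →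
      (∀ a b, H b - H a = ∫ t in a..b, h t) →
      ∀ᵐ x, x ∈ Set.uIcc a b → deriv H x = h x := by
    intro h H hh hH
    filter_upwards [(hh a b).ae_hasDerivAt_integral] with x hx hxab
    have h1 : H = fun x => (∫ t in a..x, h t) + H a := by
      ext x; rw [← hH a x]; ring
    rw [h1]
    exact ((hx hxab a Set.left_mem_uIcc).add_const _).deriv
  rw [← (hac hf hF).integral_deriv_mul_eq_sub (hac hg hG)]
  refine intervalIntegral.integral_congr_ae ?_
  filter_upwards [hderiv hf hF, hderiv hg hG] with x h1 h2 hx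
  rw [h1 (Set.uIoc_subset_uIcc hx), h2 (Set.uIoc_subset_uIcc hx)]

/-- `F` is an absolutely continuous function with the locally integrable derivative `f`. -/
def IsACPrimitive (F f : ℝ → ℂ) : Prop :=
  (∀ a b, IntervalIntegrable f volume a b) ∧ ∀ a b, F b - F a = ∫ t in a..b, f t

namespace IsACPrimitive

variable {F G f g : ℝ → ℂ}

lemma continuous (h : IsACPrimitive F f) : Continuous F := by
  have h1 : F = fun x => (∫ t in (0 : ℝ)..x, f t) + F 0 := by
    ext x; rw [← h.2 0 x]; ring
  rw [h1]
  exact (intervalIntegral.continuous_primitive h.1 0).add continuous_const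

lemma congr (h : IsACPrimitive F f) (hfg : ∀ t, f t = g t) : IsACPrimitive F g := by
  rwa [← funext hfg]

lemma intervalIntegral_re {a b : ℝ} (h : IntervalIntegrable f volume a b) :
    (∫ t in a..b, f t).re = ∫ t in a..b, (f t).re :=
  (Complex.reCLM.intervalIntegral_comp_comm h).symm

lemma intervalIntegral_im {a b : ℝ} (h : IntervalIntegrable f volume a b) :
    (∫ t in a..b, f t).im = ∫ t in a..b, (f t).im :=
  (Complex.imCLM.intervalIntegral_comp_comm h).symm

lemma intervalIntegrable_re {a b : ℝ} (h : IntervalIntegrable f volume a b) :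
    IntervalIntegrable (fun t => (f t).re) volume a b := ⟨h.1.re, h.2.re⟩

lemma intervalIntegrable_im {a b : ℝ} (h : IntervalIntegrable f volume a b) :
    IntervalIntegrable (fun t => (f t).im) volume a b := ⟨h.1.im, h.2.im⟩

lemma re_sub (h : IsACPrimitive F f) (a b : ℝ) :
    (F b).re - (F a).re = ∫ t in a..b, (f t).re := by
  rw [← intervalIntegral_re (h.1 a b), ← h.2 a b, Complex.sub_re]

lemma im_sub (h : IsACPrimitive F f) (a b : ℝ) :
    (F b).im - (F a).im = ∫ t in a..b, (f t).im := by
  rw [← intervalIntegral_im (h.1 a b), ← h.2 a b, Complex.sub_im]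

lemma mk_re_im (hf : ∀ a b, IntervalIntegrable f volume a b)
    (hre : ∀ a b, (F b).re - (F a).re = ∫ t in a..b, (f t).re)
    (him : ∀ a b, (F b).im - (F a).im = ∫ t in a..b, (f t).im) : IsACPrimitive F f := by
  refine ⟨hf, fun a b => Complex.ext ?_ ?_⟩
  · rw [Complex.sub_re, hre, intervalIntegral_re (hf a b)]
  · rw [Complex.sub_im, him, intervalIntegral_im (hf a b)]

lemma add (hF : IsACPrimitive F f) (hG : IsACPrimitive G g) :
    IsACPrimitive (fun t => F t + G t) (fun t => f t + g t) := by
  refine ⟨fun a b => (hF.1 a b).add (hG.1 a b), fun a b => ?_⟩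
  rw [intervalIntegral.integral_add (hF.1 a b) (hG.1 a b), ← hF.2, ← hG.2]
  ring

lemma const_mul (c : ℂ) (hF : IsACPrimitive F f) :
    IsACPrimitive (fun t => c * F t) (fun t => c * f t) := by
  refine ⟨fun a b => (hF.1 a b).const_mul c, fun a b => ?_⟩
  rw [intervalIntegral.integral_const_mul, ← hF.2]
  ring

lemma conj (hF : IsACPrimitive F f) :
    IsACPrimitive (fun t => (starRingEnd ℂ) (F t)) (fun t => (starRingEnd ℂ) (f t)) := by
  have hint : ∀ a b, IntervalIntegrable (fun t => (starRingEnd ℂ) (f t)) volume a b :=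
    fun a b => ⟨(Complex.conjCLE : ℂ →L[ℝ] ℂ).integrable_comp (hF.1 a b).1,
      (Complex.conjCLE : ℂ →L[ℝ] ℂ).integrable_comp (hF.1 a b).2⟩
  refine mk_re_im hint (fun a b => ?_) (fun a b => ?_)
  · simpa using hF.re_sub a b
  · simp only [Complex.conj_im, intervalIntegral.integral_neg]
    rw [← hF.im_sub a b]
    ring

/-- Expanding in real and imaginary parts reduces this to the real product rule. It replaces
differentiation in the conservation laws below, where the potential is merely integrable. -/
lemma mul (hF : IsACPrimitive F f) (hG : IsACPrimitive G g) :
    IsACPrimitive (fun t => F t * G t) (fun t => f t * G t + F t * g t) := by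
  have hint : ∀ a b, IntervalIntegrable (fun t => f t * G t + F t * g t) volume a b := fun a b =>
    ((hF.1 a b).mul_continuousOn hG.continuous.continuousOn).add
      ((hG.1 a b).continuousOn_mul hF.continuous.continuousOn)
  have hFr := fun a b => intervalIntegrable_re (hF.1 a b)
  have hFi := fun a b => intervalIntegrable_im (hF.1 a b)
  have hGr := fun a b => intervalIntegrable_re (hG.1 a b)
  have hGi := fun a b => intervalIntegrable_im (hG.1 a b)
  have hFc := hF.continuous
  have hGc := hG.continuous
  have hpi : ∀ {u v U V : ℝ → ℝ}, (∀ a b, IntervalIntegrable u volume a b) →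
      (∀ a b, IntervalIntegrable v volume a b) → Continuous U → Continuous V → ∀ a b,
      IntervalIntegrable (fun t => u t * V t + U t * v t) volume a b := fun hu hv hU hV a b =>
    ((hu a b).mul_continuousOn hV.continuousOn).add ((hv a b).continuousOn_mul hU.continuousOn)
  have hrc : Continuous fun t => (F t).re := Complex.continuous_re.comp hFc
  have hic : Continuous fun t => (F t).im := Complex.continuous_im.comp hFc
  have hrc' : Continuous fun t => (G t).re := Complex.continuous_re.comp hGc
  have hic' : Continuous fun t => (G t).im := Complex.continuous_im.comp hGc
  refine mk_re_im hint (fun a b => ?_) (fun a b => ?_)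
  · have h1 := mul_sub_mul_eq_integral_real hFr hGr hF.re_sub hG.re_sub a b
    have h2 := mul_sub_mul_eq_integral_real hFi hGi hF.im_sub hG.im_sub a b
    have h3 : (F b * G b).re - (F a * G a).re = ((F b).re * (G b).re - (F a).re * (G a).re) -
      ((F b).im * (G b).im - (F a).im * (G a).im) := by simp only [Complex.mul_re]; ring
    rw [h3, h1, h2, ← intervalIntegral.integral_sub (hpi hFr hGr hrc hrc' a b)
      (hpi hFi hGi hic hic' a b)]
    congr 1
    ext t
    simp only [Complex.mul_re, Complex.add_re]
    ring
  · have h1 := mul_sub_mul_eq_integral_real hFr hGi hF.re_sub hG.im_sub a b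
    have h2 := mul_sub_mul_eq_integral_real hFi hGr hF.im_sub hG.re_sub a b
    have h3 : (F b * G b).im - (F a * G a).im = ((F b).re * (G b).im - (F a).re * (G a).im) +
      ((F b).im * (G b).re - (F a).im * (G a).re) := by simp only [Complex.mul_im]; ring
    rw [h3, h1, h2, ← intervalIntegral.integral_add (hpi hFr hGi hrc hic' a b)
      (hpi hFi hGr hic hrc' a b)]
    congr 1
    ext t
    simp only [Complex.mul_im, Complex.add_im]
    ring

lemma of_hasDerivAt (h : ∀ t, HasDerivAt F (f t) t) (hf : Continuous f) : IsACPrimitive F f :=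
  ⟨fun a b => hf.intervalIntegrable a b, fun a b =>
    (intervalIntegral.integral_eq_sub_of_hasDerivAt (fun t _ => h t)
      (hf.intervalIntegrable a b)).symm⟩

lemma exp_const_mul (c : ℂ) :
    IsACPrimitive (fun t : ℝ => Complex.exp (c * t)) (fun t : ℝ => c * Complex.exp (c * t)) := by
  refine of_hasDerivAt (fun t => ?_) (by fun_prop)
  have h := ((Complex.ofRealCLM.hasDerivAt (x := t)).const_mul c).cexp
  simpa [mul_comm] using h

lemma integral_Iic (hf : ∀ t, IntegrableOn f (Set.Iic t)) :
    IsACPrimitive (fun t => ∫ s in Set.Iic t, f s) f := by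
  refine ⟨fun a b => ?_, fun a b => intervalIntegral.integral_Iic_sub_Iic (hf a) (hf b)⟩
  rw [intervalIntegrable_iff]
  exact (hf (max a b)).mono_set fun x hx => hx.2

end IsACPrimitive

/-! ### Holomorphic parameter integrals and Volterra operators -/

/-- A parameter integral of a dominated holomorphic family is holomorphic. -/
lemma differentiableOn_integral_of_dominated {μ : Measure ℝ} {U : Set ℂ} (hU : IsOpen U)
    {F : ℂ → ℝ → ℂ} {bound : ℝ → ℝ} (hbound : Integrable bound μ)
    (hm : ∀ z ∈ U, AEStronglyMeasurable (F z) μ)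
    (hle : ∀ᵐ s ∂μ, ∀ z ∈ U, ‖F z s‖ ≤ bound s)
    (hd : ∀ᵐ s ∂μ, DifferentiableOn ℂ (fun z => F z s) U) :
    DifferentiableOn ℂ (fun z => ∫ s, F z s ∂μ) U := by
  intro z₀ hz₀
  obtain ⟨R, hR, hRU⟩ := Metric.isOpen_iff.1 hU z₀ hz₀
  have hsub : ∀ z ∈ Metric.ball z₀ (R / 2), Metric.closedBall z (R / 4) ⊆ U := by
    intro z hz w hw
    refine hRU ?_
    rw [Metric.mem_ball] at hz ⊢
    rw [Metric.mem_closedBall] at hw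
    linarith [dist_triangle w z z₀]
  have hball : ∀ z ∈ Metric.ball z₀ (R / 2), z ∈ U := fun z hz =>
    hsub z hz (Metric.mem_closedBall_self (by positivity))
  have hnhds : Metric.ball z₀ (R / 2) ∈ 𝓝 z₀ := Metric.ball_mem_nhds _ (by positivity)
  have hderiv : ∀ᵐ s ∂μ, ∀ z ∈ Metric.ball z₀ (R / 2),
      HasDerivAt (fun z => F z s) (deriv (fun z => F z s) z) z := by
    filter_upwards [hd] with s hs z hz
    exact (hs.differentiableAt (hU.mem_nhds (hball z hz))).hasDerivAt
  -- The derivative at z₀ is measurable in s as a limit of difference quotients along steps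
  -- (R/4)/(n+1), which stay inside U.
  have hmeas : AEStronglyMeasurable (fun s => deriv (fun z => F z s) z₀) μ := by
    have hseq : Tendsto (fun n : ℕ => (((R / 4) * (1 / ((n : ℝ) + 1)) : ℝ) : ℂ)) atTop
        (𝓝[≠] 0) := by
      refine tendsto_nhdsWithin_iff.2 ⟨?_, Eventually.of_forall fun n => ?_⟩
      · have h := (tendsto_one_div_add_atTop_nhds_zero_nat (𝕜 := ℝ)).const_mul (R / 4)
        rw [mul_zero] at h
        exact (Complex.continuous_ofReal.tendsto 0).comp h
      · simp only [Set.mem_compl_iff, Set.mem_singleton_iff, Complex.ofReal_eq_zero]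
        positivity
    have hin : ∀ n : ℕ, z₀ + (((R / 4) * (1 / ((n : ℝ) + 1)) : ℝ) : ℂ) ∈ U := by
      intro n
      refine hsub z₀ (Metric.mem_ball_self (by positivity)) ?_
      rw [mem_closedBall_iff_norm, add_sub_cancel_left, Complex.norm_real, Real.norm_eq_abs,
        abs_of_pos (by positivity)]
      refine mul_le_of_le_one_right (by positivity) ?_
      rw [div_le_one (by positivity)]
      linarith [(Nat.cast_nonneg n : (0 : ℝ) ≤ n)]
    refine aestronglyMeasurable_of_tendsto_ae atTop (fun n : ℕ => ?_) ?_
      (f := fun (n : ℕ) s => (((R / 4) * (1 / ((n : ℝ) + 1)) : ℝ) : ℂ)⁻¹ •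
        (F (z₀ + (((R / 4) * (1 / ((n : ℝ) + 1)) : ℝ) : ℂ)) s - F z₀ s))
    · exact ((hm _ (hin n)).sub (hm _ hz₀)).const_smul
        (((R / 4) * (1 / ((n : ℝ) + 1)) : ℝ) : ℂ)⁻¹
    · filter_upwards [hderiv] with s hs
      exact (hs z₀ (Metric.mem_ball_self (by positivity))).tendsto_slope_zero.comp hseq
  -- Cauchy's estimate on circles of radius R/4 turns the bound on F into a bound on its derivative.
  have hb : ∀ᵐ s ∂μ, ∀ z ∈ Metric.ball z₀ (R / 2),
      ‖deriv (fun z => F z s) z‖ ≤ bound s / (R / 4) := by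
    filter_upwards [hd, hle] with s hs hls z hz
    refine Complex.norm_deriv_le_of_forall_mem_sphere_norm_le (by positivity) ?_
      fun w hw => hls w (hsub z hz (Metric.sphere_subset_closedBall hw))
    exact (hs.mono (hsub z hz)).diffContOnCl_ball subset_rfl
  have hint : Integrable (F z₀) μ := hbound.mono' (hm z₀ hz₀) (hle.mono fun s hs => hs z₀ hz₀)
  have key := hasDerivAt_integral_of_dominated_loc_of_deriv_le (μ := μ) (𝕜 := ℂ) hnhds
    (by filter_upwards [hnhds] with z hz using hm z (hball z hz)) hint hmeas hb
    (hbound.div_const _) hderiv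
  exact key.2.differentiableAt.differentiableWithinAt

/-- The Volterra operator with the kernel `exp (2 i ζ (t - s)) p s`. -/
def volterra (ζ : ℂ) (p f : ℝ → ℂ) (t : ℝ) : ℂ :=
  ∫ s in Set.Iic t, Complex.exp (2 * Complex.I * ζ * ((t : ℂ) - s)) * (p s * f s)

/-- The mass of `q` up to the time `t`. -/
def massUpTo (q : ℝ → ℂ) (t : ℝ) : ℝ := ∫ s in Set.Iic t, ‖q s‖

/-- The exponent has nonpositive real part. Thus all Volterra estimates are uniform in ζ up to and
including the real line. -/
lemma norm_exp_kernel_le {ζ : ℂ} (hζ : 0 ≤ ζ.im) {s t : ℝ} (hst : s ≤ t) :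
    ‖Complex.exp (2 * Complex.I * ζ * ((t : ℂ) - s))‖ ≤ 1 := by
  rw [Complex.norm_exp, Real.exp_le_one_iff]
  have h : (2 * Complex.I * ζ * ((t : ℂ) - s)).re = -(2 * ζ.im * (t - s)) := by
    simp
  rw [h, neg_nonpos]
  have := sub_nonneg.2 hst
  positivity

lemma norm_volterra_integrand_le {ζ : ℂ} (hζ : 0 ≤ ζ.im) {p f : ℝ → ℂ} {s t C : ℝ} (hst : s ≤ t)
    (hf : ‖f s‖ ≤ C) :
    ‖Complex.exp (2 * Complex.I * ζ * ((t : ℂ) - s)) * (p s * f s)‖ ≤ ‖p s‖ * C := by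
  rw [norm_mul, norm_mul]
  calc _ ≤ 1 * (‖p s‖ * C) := by gcongr; exact norm_exp_kernel_le hζ hst
    _ = _ := one_mul _

lemma aestronglyMeasurable_volterra_integrand {ζ : ℂ} {p f : ℝ → ℂ} (hp : Integrable p)
    (hf : Continuous f) (t : ℝ) : AEStronglyMeasurable
      (fun s : ℝ => Complex.exp (2 * Complex.I * ζ * ((t : ℂ) - s)) * (p s * f s)) volume := by
  refine AEStronglyMeasurable.mul (Continuous.aestronglyMeasurable (by fun_prop))
    (hp.aestronglyMeasurable.mul hf.aestronglyMeasurable)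

lemma integrableOn_volterra {ζ : ℂ} (hζ : 0 ≤ ζ.im) {p f : ℝ → ℂ} {C : ℝ} (hp : Integrable p)
    (hf : Continuous f) (hfC : ∀ s, ‖f s‖ ≤ C) (t : ℝ) : IntegrableOn
      (fun s : ℝ => Complex.exp (2 * Complex.I * ζ * ((t : ℂ) - s)) * (p s * f s)) (Set.Iic t) := by
  refine Integrable.mono' ((hp.norm.mul_const C).integrableOn)
    (aestronglyMeasurable_volterra_integrand hp hf t).restrict ?_
  filter_upwards [ae_restrict_mem measurableSet_Iic] with s hs
  exact norm_volterra_integrand_le hζ hs (hfC s)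

/-- The kernel factors as exp(2iζt) exp(-2iζs), so the product rule shows that the Volterra integral
solves v' = 2iζv + pf. -/
lemma isACPrimitive_volterra {ζ : ℂ} (hζ : 0 ≤ ζ.im) {p f : ℝ → ℂ} {C : ℝ} (hp : Integrable p)
    (hf : Continuous f) (hfC : ∀ s, ‖f s‖ ≤ C) : IsACPrimitive (volterra ζ p f)
      (fun t => 2 * Complex.I * ζ * volterra ζ p f t + p t * f t) := by
  have hfac : ∀ s t : ℝ, Complex.exp (2 * Complex.I * ζ * ((t : ℂ) - s)) =
      Complex.exp (2 * Complex.I * ζ * t) * Complex.exp (-(2 * Complex.I * ζ * s)) := by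
    intro s t
    rw [← Complex.exp_add]
    ring_nf
  have hfac' : ∀ s t : ℝ, Complex.exp (-(2 * Complex.I * ζ * t)) *
      (Complex.exp (2 * Complex.I * ζ * ((t : ℂ) - s)) * (p s * f s)) =
      Complex.exp (-(2 * Complex.I * ζ * s)) * (p s * f s) := by
    intro s t
    rw [← mul_assoc, ← Complex.exp_add]
    ring_nf
  have hint : ∀ t : ℝ, IntegrableOn
      (fun s : ℝ => Complex.exp (-(2 * Complex.I * ζ * s)) * (p s * f s)) (Set.Iic t) := by
    intro t
    refine ((integrableOn_volterra hζ hp hf hfC t).const_mul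
      (Complex.exp (-(2 * Complex.I * ζ * t)))).congr (Eventually.of_forall fun s => ?_)
    exact hfac' s t
  have hv : ∀ t, volterra ζ p f t = Complex.exp (2 * Complex.I * ζ * t) *
      ∫ s in Set.Iic t, Complex.exp (-(2 * Complex.I * ζ * s)) * (p s * f s) := by
    intro t
    rw [volterra, ← integral_const_mul]
    congr 1
    ext s
    rw [hfac]
    ring
  have h := (IsACPrimitive.exp_const_mul (2 * Complex.I * ζ)).mul
    (IsACPrimitive.integral_Iic hint)
  rw [← funext hv] at h
  refine h.congr fun t => ?_
  rw [hv, ← mul_assoc (Complex.exp _), ← Complex.exp_add]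
  simp
  ring

section Mass
variable {q : ℝ → ℂ}

lemma massUpTo_nonneg (q : ℝ → ℂ) (t : ℝ) : 0 ≤ massUpTo q t :=
  integral_nonneg fun _ => norm_nonneg _

lemma massUpTo_le (hq : Integrable q) (t : ℝ) : massUpTo q t ≤ ∫ s, ‖q s‖ :=
  setIntegral_le_integral hq.norm (Eventually.of_forall fun _ => norm_nonneg _)

lemma massUpTo_sub (hq : Integrable q) (a b : ℝ) :
    massUpTo q b - massUpTo q a = ∫ s in a..b, ‖q s‖ :=
  intervalIntegral.integral_Iic_sub_Iic hq.norm.integrableOn hq.norm.integrableOn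

lemma continuous_massUpTo (hq : Integrable q) : Continuous (massUpTo q) := by
  have h : massUpTo q = fun t => (∫ s in (0 : ℝ)..t, ‖q s‖) + massUpTo q 0 := by
    ext t; rw [← massUpTo_sub hq]; ring
  rw [h]
  exact (hq.norm.continuous_primitive 0).add continuous_const

/-- The chain rule for powers, obtained by induction from the product rule since the mass is only
absolutely continuous. -/
lemma massUpTo_pow_sub (hq : Integrable q) (n : ℕ) (a b : ℝ) :
    massUpTo q b ^ (n + 1) - massUpTo q a ^ (n + 1) =
      ∫ s in a..b, (n + 1 : ℝ) * (‖q s‖ * massUpTo q s ^ n) := by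
  induction n generalizing a b with
  | zero => simp [massUpTo_sub hq]
  | succ n ih =>
    have h1 : ∀ a b, IntervalIntegrable (fun s => ‖q s‖) volume a b := fun a b =>
      hq.norm.intervalIntegrable
    have h2 : ∀ a b, IntervalIntegrable (fun s => (n + 1 : ℝ) * (‖q s‖ * massUpTo q s ^ n))
        volume a b := fun a b =>
      ((h1 a b).mul_continuousOn ((continuous_massUpTo hq).pow n).continuousOn).const_mul _
    have h := mul_sub_mul_eq_integral_real h2 h1 ih (massUpTo_sub hq) a b
    rw [pow_succ, pow_succ (massUpTo q a), h]
    congr 1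
    ext s
    push_cast
    ring

lemma integrable_norm_mul_massUpTo_pow (hq : Integrable q) (n : ℕ) :
    Integrable fun s => ‖q s‖ * massUpTo q s ^ n := by
  refine Integrable.mono' (hq.norm.mul_const ((∫ s, ‖q s‖) ^ n))
    (hq.norm.aestronglyMeasurable.mul ((continuous_massUpTo hq).pow n).aestronglyMeasurable)
    (Eventually.of_forall fun s => ?_)
  have h0 := massUpTo_nonneg q s
  rw [Real.norm_of_nonneg (by positivity)]
  gcongr
  exact massUpTo_le hq s

lemma integral_norm_mul_massUpTo_pow_le (hq : Integrable q) (n : ℕ) (t : ℝ) :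
    ∫ s in Set.Iic t, ‖q s‖ * massUpTo q s ^ n ≤ massUpTo q t ^ (n + 1) / (n + 1) := by
  have h := intervalIntegral_tendsto_integral_Iic t
    (integrable_norm_mul_massUpTo_pow hq n).integrableOn (tendsto_id (α := ℝ) (x := atBot))
  refine le_of_tendsto h (Eventually.of_forall fun a => ?_)
  have h1 := massUpTo_pow_sub hq n a t
  rw [intervalIntegral.integral_const_mul] at h1
  rw [le_div_iff₀ (by positivity), mul_comm, id, ← h1]
  have := massUpTo_nonneg q a
  have : 0 ≤ massUpTo q a ^ (n + 1) := by positivity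
  linarith

lemma tendsto_massUpTo_atBot (hq : Integrable q) : Tendsto (massUpTo q) atBot (𝓝 0) := by
  have h := intervalIntegral_tendsto_integral_Iic 0 hq.norm.integrableOn
    (tendsto_id (α := ℝ) (x := atBot))
  have h2 : Tendsto (fun a => massUpTo q 0 - ∫ s in a..0, ‖q s‖) atBot
      (𝓝 (massUpTo q 0 - massUpTo q 0)) := tendsto_const_nhds.sub h
  rw [sub_self] at h2
  refine h2.congr fun a => ?_
  rw [← massUpTo_sub hq]
  ring

/-- Each application of the operator raises the power of the mass by one and divides by the next
integer. The resulting factorials make the Neumann series converge with no smallness assumption on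
q. -/
lemma norm_volterra_le (hq : Integrable q) {ζ : ℂ} (hζ : 0 ≤ ζ.im) {p f : ℝ → ℂ}
    (hpq : ∀ s, ‖p s‖ = ‖q s‖) {C : ℝ} {n : ℕ}
    (hf : ∀ s, ‖f s‖ ≤ C * (massUpTo q s ^ n / n.factorial)) (hC : 0 ≤ C) (t : ℝ) :
    ‖volterra ζ p f t‖ ≤ C * (massUpTo q t ^ (n + 1) / (n + 1).factorial) := by
  have h1 : ‖volterra ζ p f t‖ ≤
      ∫ s in Set.Iic t, (C / n.factorial) * (‖q s‖ * massUpTo q s ^ n) := by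
    refine norm_integral_le_of_norm_le
      ((integrable_norm_mul_massUpTo_pow hq n).const_mul _).integrableOn ?_
    filter_upwards [ae_restrict_mem measurableSet_Iic] with s hs
    refine (norm_volterra_integrand_le hζ hs (hf s)).trans (le_of_eq ?_)
    rw [hpq]
    ring
  rw [integral_const_mul] at h1
  refine h1.trans ?_
  refine (mul_le_mul_of_nonneg_left (integral_norm_mul_massUpTo_pow_le hq n t)
    (by positivity)).trans (le_of_eq ?_)
  rw [Nat.factorial_succ]
  push_cast
  field_simp

end Mass

lemma hasSum_volterra {ζ : ℂ} (hζ : 0 ≤ ζ.im) {p : ℝ → ℂ} (hp : Integrable p)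
    {f : ℕ → ℝ → ℂ} {u : ℕ → ℝ} (hf : ∀ n, Continuous (f n)) (hfu : ∀ n s, ‖f n s‖ ≤ u n)
    (hu : Summable u) (t : ℝ) :
    HasSum (fun n => volterra ζ p (f n) t) (volterra ζ p (fun s => ∑' n, f n s) t) := by
  have hsum : ∀ s, Summable fun n => f n s := fun s => Summable.of_norm_bounded hu fun n => hfu n s
  have h := hasSum_integral_of_summable_integral_norm (μ := volume.restrict (Set.Iic t))
    (F := fun n s => Complex.exp (2 * Complex.I * ζ * ((t : ℂ) - s)) * (p s * f n s))
    (fun n => integrableOn_volterra hζ hp (hf n) (hfu n) t) ?_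
  · simp only [tsum_mul_left] at h
    exact h
  · refine Summable.of_nonneg_of_le (fun n => integral_nonneg fun s => norm_nonneg _) (fun n => ?_)
      (hu.mul_left (∫ s in Set.Iic t, ‖p s‖))
    rw [← integral_mul_const]
    refine integral_mono_of_nonneg (Eventually.of_forall fun s => norm_nonneg _)
      (hp.norm.mul_const _).integrableOn ?_
    filter_upwards [ae_restrict_mem measurableSet_Iic] with s hs
    exact norm_volterra_integrand_le hζ hs (hfu n s)

section Parameter
variable {κ : ℂ → ℂ} {p : ℝ → ℂ} {f : ℂ → ℝ → ℂ} {C : ℝ}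

/-- The map κ covers both rows of the system: κ = 0 for the first component and κ = id for the
second. -/
lemma differentiableOn_volterra (hκ : Differentiable ℂ κ)
    (hκim : ∀ z : ℂ, 0 ≤ z.im → 0 ≤ (κ z).im) (hp : Integrable p)
    (hf : ∀ z : ℂ, 0 ≤ z.im → Continuous (f z)) (hfC : ∀ z : ℂ, 0 ≤ z.im → ∀ s, ‖f z s‖ ≤ C)
    (hfd : ∀ s, DifferentiableOn ℂ (fun z => f z s) {z : ℂ | 0 < z.im}) (t : ℝ) :
    DifferentiableOn ℂ (fun z => volterra (κ z) p (f z) t) {z : ℂ | 0 < z.im} := by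
  refine differentiableOn_integral_of_dominated isOpen_im_pos
    ((hp.norm.mul_const C).integrableOn (s := Set.Iic t)) (fun z hz => ?_) ?_ ?_
  · exact (aestronglyMeasurable_volterra_integrand hp (hf z (le_of_lt hz)) t).restrict
  · filter_upwards [ae_restrict_mem measurableSet_Iic] with s hs z hz
    exact norm_volterra_integrand_le (hκim z (le_of_lt hz)) hs (hfC z (le_of_lt hz) s)
  · refine Eventually.of_forall fun s => ?_
    have := hfd s
    have := hκ.differentiableOn (s := {z : ℂ | 0 < z.im})
    fun_prop

lemma continuousOn_volterra (hκ : Continuous κ)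
    (hκim : ∀ z : ℂ, 0 ≤ z.im → 0 ≤ (κ z).im) (hp : Integrable p)
    (hf : ∀ z : ℂ, 0 ≤ z.im → Continuous (f z)) (hfC : ∀ z : ℂ, 0 ≤ z.im → ∀ s, ‖f z s‖ ≤ C)
    (hfd : ∀ s, ContinuousOn (fun z => f z s) {z : ℂ | 0 ≤ z.im}) (t : ℝ) :
    ContinuousOn (fun z => volterra (κ z) p (f z) t) {z : ℂ | 0 ≤ z.im} := by
  intro z₀ hz₀
  refine continuousWithinAt_of_dominated (bound := fun s => ‖p s‖ * C) ?_ ?_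
    (hp.norm.mul_const C).integrableOn ?_
  · filter_upwards [self_mem_nhdsWithin] with z hz
    exact (aestronglyMeasurable_volterra_integrand hp (hf z hz) t).restrict
  · filter_upwards [self_mem_nhdsWithin] with z hz
    filter_upwards [ae_restrict_mem measurableSet_Iic] with s hs
    exact norm_volterra_integrand_le (hκim z hz) hs (hfC z hz s)
  · refine Eventually.of_forall fun s => ?_
    have h1 := hfd s z₀ hz₀
    have h2 : ContinuousWithinAt κ {z : ℂ | 0 ≤ z.im} z₀ := hκ.continuousWithinAt
    fun_prop

end Parameter

/-- The Riemann-Lebesgue lemma, uniformly in the closed upper half plane. -/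
lemma exists_norm_volterra_one_le {p : ℝ → ℂ} (hp : Integrable p) {ε : ℝ} (hε : 0 < ε) :
    ∃ R : ℝ, ∀ ζ : ℂ, 0 ≤ ζ.im → R ≤ ‖ζ‖ → ∀ t, ‖volterra ζ p (fun _ => 1) t‖ ≤ ε := by
  -- Split p into a smooth compactly supported g and a remainder of L¹ norm at most ε/2. The
  -- remainder is controlled by its norm, the smooth part by integration by parts.
  obtain ⟨g, hgs, hgd, hg⟩ := (memLp_one_iff_integrable.2 hp).exist_eLpNorm_sub_le
    ENNReal.one_ne_top le_rfl (half_pos hε)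
  have hgd1 : Differentiable ℝ g := hgd.differentiable (by simp)
  have hg' : Continuous (deriv g) := hgd.continuous_deriv (by simp)
  have hgi : Integrable g := hgd.continuous.integrable_of_hasCompactSupport hgs
  have hgi' : Integrable (deriv g) := hg'.integrable_of_hasCompactSupport hgs.deriv
  have hpgi : Integrable fun s => p s - g s := hp.sub hgi
  have hpg : ∫ s, ‖p s - g s‖ ≤ ε / 2 := by
    rw [eLpNorm_one_eq_lintegral_enorm] at hg
    rw [integral_norm_eq_lintegral_enorm hpgi.aestronglyMeasurable]
    exact ENNReal.toReal_le_of_le_ofReal (half_pos hε).le hg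
  obtain ⟨K, hK⟩ := hgd.continuous.bounded_above_of_compact_support hgs
  have hK0 : 0 ≤ K := (norm_nonneg _).trans (hK 0)
  set D := K + ∫ s, ‖deriv g s‖ with hD
  have hD0 : 0 ≤ D := add_nonneg hK0 (integral_nonneg fun _ => norm_nonneg _)
  -- Integration by parts gives 2‖ζ‖‖V‖ ≤ D for the smooth part V, and D ≤ ‖ζ‖ε leaves ε/2; the
  -- summand 1 keeps ζ away from 0.
  refine ⟨D / ε + 1, fun ζ hζ hR t => ?_⟩
  have hζ0 : 0 < ‖ζ‖ := lt_of_lt_of_le (by positivity) hR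
  have hbound : ∀ h : ℝ → ℂ, Integrable h → ‖volterra ζ h (fun _ => 1) t‖ ≤ ∫ s, ‖h s‖ := by
    intro h hh
    have h1 : ‖volterra ζ h (fun _ => 1) t‖ ≤ ∫ s in Set.Iic t, ‖h s‖ := by
      refine norm_integral_le_of_norm_le hh.norm.integrableOn ?_
      filter_upwards [ae_restrict_mem measurableSet_Iic] with s hs
      simpa using norm_volterra_integrand_le (p := h) (f := fun _ => 1) hζ hs (C := 1) (by simp)
    exact h1.trans (setIntegral_le_integral hh.norm (Eventually.of_forall fun _ => norm_nonneg _))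
  have hi : ∀ h : ℝ → ℂ, Integrable h → IntegrableOn
      (fun s : ℝ => Complex.exp (2 * Complex.I * ζ * ((t : ℂ) - s)) * (h s * 1)) (Set.Iic t) :=
    fun h hh => integrableOn_volterra (f := fun _ => 1) hζ hh continuous_const
      (C := 1) (by simp) t
  have hsplit : volterra ζ p (fun _ => 1) t =
      volterra ζ (fun s => p s - g s) (fun _ => 1) t + volterra ζ g (fun _ => 1) t := by
    rw [volterra, volterra, volterra, ← integral_add (hi _ hpgi) (hi _ hgi)]
    congr 1
    ext s
    ring
  have hparts : volterra ζ (deriv g) (fun _ => 1) t -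
      2 * Complex.I * ζ * volterra ζ g (fun _ => 1) t = g t := by
    have hder : ∀ s ∈ Set.Iic t, HasDerivAt
        (fun s : ℝ => Complex.exp (2 * Complex.I * ζ * ((t : ℂ) - s)) * g s)
        (Complex.exp (2 * Complex.I * ζ * ((t : ℂ) - s)) * (deriv g s * 1) -
          2 * Complex.I * ζ *
            (Complex.exp (2 * Complex.I * ζ * ((t : ℂ) - s)) * (g s * 1))) s := by
      intro s _
      have h1 := ((Complex.ofRealCLM.hasDerivAt (x := s)).const_sub (t : ℂ)).const_mul
        (2 * Complex.I * ζ)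
      refine (h1.cexp.mul (hgd1 s).hasDerivAt).congr_deriv ?_
      simp
      ring
    have hlim : Tendsto (fun s : ℝ => Complex.exp (2 * Complex.I * ζ * ((t : ℂ) - s)) * g s)
        atBot (𝓝 0) := by
      have h1 : ∀ᶠ s in atBot, g s = 0 := by
        obtain ⟨r, hr⟩ := hgs.isCompact.isBounded.subset_closedBall 0
        filter_upwards [eventually_lt_atBot (-r)] with s hs
        by_contra h0
        have h2 := hr (subset_tsupport g h0)
        rw [mem_closedBall_zero_iff, Real.norm_eq_abs, abs_le] at h2
        linarith [h2.1]
      refine tendsto_const_nhds.congr' ?_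
      filter_upwards [h1] with s hs
      rw [hs, mul_zero]
    have h2 := integral_Iic_of_hasDerivAt_of_tendsto' hder
      ((hi _ hgi').sub ((hi _ hgi).const_mul _)) hlim
    rw [integral_sub (hi _ hgi') ((hi _ hgi).const_mul _), integral_const_mul] at h2
    simpa [volterra] using h2
  have hgt : ‖volterra ζ g (fun _ => 1) t‖ ≤ ε / 2 := by
    have h1 : 2 * Complex.I * ζ * volterra ζ g (fun _ => 1) t =
        volterra ζ (deriv g) (fun _ => 1) t - g t := by rw [← hparts]; ring
    have h2 : 2 * ‖ζ‖ * ‖volterra ζ g (fun _ => 1) t‖ ≤ D := by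
      have h3 : ‖2 * Complex.I * ζ * volterra ζ g (fun _ => 1) t‖ =
          2 * ‖ζ‖ * ‖volterra ζ g (fun _ => 1) t‖ := by simp
      rw [← h3, h1]
      refine (norm_sub_le _ _).trans ?_
      rw [hD, add_comm]
      exact add_le_add (hK t) (hbound _ hgi')
    have h4 : D ≤ ‖ζ‖ * ε := by
      have : D / ε ≤ ‖ζ‖ := by linarith
      rwa [div_le_iff₀ hε] at this
    nlinarith
  rw [hsplit]
  refine (norm_add_le _ _).trans ?_
  linarith [hbound _ hpgi]

/-! ### Jost solutions -/

/-- The terms of the Neumann series of the Jost solution of the system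
`X' = q Y`, `Y' = - conj q X + 2 i ξ Y`. -/
def jostTerm (q : ℝ → ℂ) (ξ : ℂ) : ℕ → (ℝ → ℂ) × (ℝ → ℂ)
  | 0 => (fun _ => 1, fun _ => 0)
  | n + 1 => (volterra 0 q (jostTerm q ξ n).2,
      volterra ξ (fun s => -(starRingEnd ℂ) (q s)) (jostTerm q ξ n).1)

/-- The first component of the Jost solution that tends to `(1, 0)` at `-∞`. -/
def jostX (q : ℝ → ℂ) (ξ : ℂ) (t : ℝ) : ℂ := ∑' n, (jostTerm q ξ n).1 t

/-- The second component of the Jost solution that tends to `(1, 0)` at `-∞`. -/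
def jostY (q : ℝ → ℂ) (ξ : ℂ) (t : ℝ) : ℂ := ∑' n, (jostTerm q ξ n).2 t

section Jost
variable {q : ℝ → ℂ}

lemma integrable_neg_conj (hq : Integrable q) :
    Integrable fun s => -(starRingEnd ℂ) (q s) :=
  ((Complex.conjCLE : ℂ →L[ℝ] ℂ).integrable_comp hq).neg

/-- Continuity and the bounds go through one induction, because continuity of the next iterate needs
boundedness of the current one. -/
lemma jostTerm_bound (hq : Integrable q) {ξ : ℂ} (hξ : 0 ≤ ξ.im) (n : ℕ) :
    (Continuous (jostTerm q ξ n).1 ∧ Continuous (jostTerm q ξ n).2) ∧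
      ∀ t, ‖(jostTerm q ξ n).1 t‖ ≤ massUpTo q t ^ n / n.factorial ∧
        ‖(jostTerm q ξ n).2 t‖ ≤ massUpTo q t ^ n / n.factorial := by
  induction n with
  | zero => exact ⟨⟨continuous_const, continuous_const⟩, fun t => by simp [jostTerm]⟩
  | succ n ih =>
    obtain ⟨⟨hc1, hc2⟩, hb⟩ := ih
    have hB : ∀ t, massUpTo q t ^ n / n.factorial ≤ (∫ s, ‖q s‖) ^ n / n.factorial := fun t => by
      have := massUpTo_nonneg q t
      gcongr
      exact massUpTo_le hq t
    refine ⟨⟨?_, ?_⟩, fun t => ⟨?_, ?_⟩⟩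
    · exact (isACPrimitive_volterra (by simp) hq hc2
        fun s => (hb s).2.trans (hB s)).continuous
    · exact (isACPrimitive_volterra hξ (integrable_neg_conj hq) hc1
        fun s => (hb s).1.trans (hB s)).continuous
    · simpa [jostTerm] using norm_volterra_le hq (ζ := 0) (by simp) (p := q) (fun _ => rfl) (C := 1) (n := n)
        (fun s => by simpa using (hb s).2) zero_le_one t
    · simpa [jostTerm] using norm_volterra_le hq hξ (p := fun s => -(starRingEnd ℂ) (q s))
        (fun _ => by simp) (C := 1) (n := n) (fun s => by simpa using (hb s).1) zero_le_one t

lemma continuous_jostTerm_fst (hq : Integrable q) {ξ : ℂ} (hξ : 0 ≤ ξ.im) (n : ℕ) :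
    Continuous (jostTerm q ξ n).1 := (jostTerm_bound hq hξ n).1.1

lemma continuous_jostTerm_snd (hq : Integrable q) {ξ : ℂ} (hξ : 0 ≤ ξ.im) (n : ℕ) :
    Continuous (jostTerm q ξ n).2 := (jostTerm_bound hq hξ n).1.2

lemma massUpTo_pow_div_le (hq : Integrable q) (n : ℕ) (t : ℝ) :
    massUpTo q t ^ n / n.factorial ≤ (∫ s, ‖q s‖) ^ n / n.factorial := by
  have := massUpTo_nonneg q t
  gcongr
  exact massUpTo_le hq t

lemma norm_jostTerm_fst_le (hq : Integrable q) {ξ : ℂ} (hξ : 0 ≤ ξ.im) (n : ℕ) (t : ℝ) :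
    ‖(jostTerm q ξ n).1 t‖ ≤ (∫ s, ‖q s‖) ^ n / n.factorial :=
  ((jostTerm_bound hq hξ n).2 t).1.trans (massUpTo_pow_div_le hq n t)

lemma norm_jostTerm_snd_le (hq : Integrable q) {ξ : ℂ} (hξ : 0 ≤ ξ.im) (n : ℕ) (t : ℝ) :
    ‖(jostTerm q ξ n).2 t‖ ≤ (∫ s, ‖q s‖) ^ n / n.factorial :=
  ((jostTerm_bound hq hξ n).2 t).2.trans (massUpTo_pow_div_le hq n t)

lemma summable_mass (q : ℝ → ℂ) : Summable fun n : ℕ => (∫ s, ‖q s‖) ^ n / n.factorial :=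
  Real.summable_pow_div_factorial _

lemma summable_jostTerm_fst (hq : Integrable q) {ξ : ℂ} (hξ : 0 ≤ ξ.im) (t : ℝ) :
    Summable fun n => (jostTerm q ξ n).1 t :=
  Summable.of_norm_bounded (summable_mass q) fun n => norm_jostTerm_fst_le hq hξ n t

lemma summable_jostTerm_snd (hq : Integrable q) {ξ : ℂ} (hξ : 0 ≤ ξ.im) (t : ℝ) :
    Summable fun n => (jostTerm q ξ n).2 t :=
  Summable.of_norm_bounded (summable_mass q) fun n => norm_jostTerm_snd_le hq hξ n t

lemma continuous_jostX (hq : Integrable q) {ξ : ℂ} (hξ : 0 ≤ ξ.im) : Continuous (jostX q ξ) :=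
  continuous_tsum (continuous_jostTerm_fst hq hξ) (summable_mass q) (norm_jostTerm_fst_le hq hξ)

lemma continuous_jostY (hq : Integrable q) {ξ : ℂ} (hξ : 0 ≤ ξ.im) : Continuous (jostY q ξ) :=
  continuous_tsum (continuous_jostTerm_snd hq hξ) (summable_mass q) (norm_jostTerm_snd_le hq hξ)

lemma norm_jostX_le (hq : Integrable q) {ξ : ℂ} (hξ : 0 ≤ ξ.im) (t : ℝ) :
    ‖jostX q ξ t‖ ≤ ∑' n : ℕ, (∫ s, ‖q s‖) ^ n / n.factorial :=
  tsum_of_norm_bounded (summable_mass q).hasSum fun n => norm_jostTerm_fst_le hq hξ n t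

lemma norm_jostY_le (hq : Integrable q) {ξ : ℂ} (hξ : 0 ≤ ξ.im) (t : ℝ) :
    ‖jostY q ξ t‖ ≤ ∑' n : ℕ, (∫ s, ‖q s‖) ^ n / n.factorial :=
  tsum_of_norm_bounded (summable_mass q).hasSum fun n => norm_jostTerm_snd_le hq hξ n t

lemma jostX_eq (hq : Integrable q) {ξ : ℂ} (hξ : 0 ≤ ξ.im) (t : ℝ) :
    jostX q ξ t = 1 + volterra 0 q (jostY q ξ) t := by
  have h := hasSum_volterra (ζ := 0) (by simp) hq (continuous_jostTerm_snd hq hξ)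
    (norm_jostTerm_snd_le hq hξ) (summable_mass q) t
  rw [jostX, (summable_jostTerm_fst hq hξ t).tsum_eq_zero_add]
  exact congrArg (1 + ·) h.tsum_eq

lemma jostY_eq (hq : Integrable q) {ξ : ℂ} (hξ : 0 ≤ ξ.im) (t : ℝ) :
    jostY q ξ t = volterra ξ (fun s => -(starRingEnd ℂ) (q s)) (jostX q ξ) t := by
  have h := hasSum_volterra hξ (integrable_neg_conj hq) (continuous_jostTerm_fst hq hξ)
    (norm_jostTerm_fst_le hq hξ) (summable_mass q) t
  rw [jostY, (summable_jostTerm_snd hq hξ t).tsum_eq_zero_add]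
  exact (zero_add _).trans h.tsum_eq

lemma isACPrimitive_jostX (hq : Integrable q) {ξ : ℂ} (hξ : 0 ≤ ξ.im) :
    IsACPrimitive (jostX q ξ) (fun t => q t * jostY q ξ t) := by
  have h := isACPrimitive_volterra (ζ := 0) (by simp) hq (continuous_jostY hq hξ)
    (norm_jostY_le hq hξ)
  refine ⟨fun a b => ((h.congr fun t => by simp).1 a b), fun a b => ?_⟩
  rw [jostX_eq hq hξ, jostX_eq hq hξ, add_sub_add_left_eq_sub, h.2 a b]
  simp

lemma isACPrimitive_jostY (hq : Integrable q) {ξ : ℂ} (hξ : 0 ≤ ξ.im) :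
    IsACPrimitive (jostY q ξ)
      (fun t => 2 * Complex.I * ξ * jostY q ξ t - (starRingEnd ℂ) (q t) * jostX q ξ t) := by
  have h := isACPrimitive_volterra hξ (integrable_neg_conj hq) (continuous_jostX hq hξ)
    (norm_jostX_le hq hξ)
  rw [← funext (jostY_eq hq hξ)] at h
  exact h.congr fun t => by ring

/-- Bounds for the Jost solution in terms of its first iterate. -/
lemma norm_jost_sub_le (hq : Integrable q) {ξ : ℂ} (hξ : 0 ≤ ξ.im) {δ : ℝ}
    (h0 : 0 ≤ δ) (hδ : ∀ t, ‖(jostTerm q ξ 1).2 t‖ ≤ δ) (t : ℝ) :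
    ‖jostX q ξ t - 1‖ ≤ δ * ∑' n : ℕ, (∫ s, ‖q s‖) ^ n / n.factorial ∧
      ‖jostY q ξ t‖ ≤ δ * ∑' n : ℕ, (∫ s, ‖q s‖) ^ n / n.factorial := by
  -- At index 1 the first component is 0, since the second component starts at 0. Hence all later
  -- iterates are generated by the second component at index 1 and carry the factor δ.
  have hb : ∀ n : ℕ, ∀ t, ‖(jostTerm q ξ (n + 1)).1 t‖ ≤ δ * (massUpTo q t ^ n / n.factorial) ∧
      ‖(jostTerm q ξ (n + 1)).2 t‖ ≤ δ * (massUpTo q t ^ n / n.factorial) := by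
    intro n
    induction n with
    | zero =>
      intro t
      refine ⟨?_, by simpa using hδ t⟩
      simp [jostTerm, volterra, h0]
    | succ n ih =>
      intro t
      exact ⟨norm_volterra_le hq (ζ := 0) (by simp) (fun _ => rfl) (fun s => (ih s).2) h0 t,
        norm_volterra_le hq hξ (fun _ => by simp) (fun s => (ih s).1) h0 t⟩
  have hb' : ∀ n : ℕ, δ * (massUpTo q t ^ n / n.factorial) ≤
      δ * ((∫ s, ‖q s‖) ^ n / n.factorial) := fun n =>
    mul_le_mul_of_nonneg_left (massUpTo_pow_div_le hq n t) h0
  have hs := (summable_mass q).mul_left δ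
  rw [← tsum_mul_left]
  constructor
  · rw [jostX, (summable_jostTerm_fst hq hξ t).tsum_eq_zero_add]
    have : (jostTerm q ξ 0).1 t = 1 := rfl
    rw [this, add_sub_cancel_left]
    exact tsum_of_norm_bounded hs.hasSum fun n => (hb n t).1.trans (hb' n)
  · rw [jostY, (summable_jostTerm_snd hq hξ t).tsum_eq_zero_add]
    have : (jostTerm q ξ 0).2 t = 0 := rfl
    rw [this, zero_add]
    exact tsum_of_norm_bounded hs.hasSum fun n => (hb n t).2.trans (hb' n)

/-- The Jost solution tends to `(1, 0)` as `|ξ| → ∞`, uniformly in the time and in the closed upper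
half plane. -/
lemma exists_norm_jost_sub_le (hq : Integrable q) {ε : ℝ} (hε : 0 < ε) :
    ∃ R : ℝ, ∀ ξ : ℂ, 0 ≤ ξ.im → R ≤ ‖ξ‖ → ∀ t,
      ‖jostX q ξ t - 1‖ ≤ ε ∧ ‖jostY q ξ t‖ ≤ ε := by
  set S := ∑' n : ℕ, (∫ s, ‖q s‖) ^ n / n.factorial with hS
  have hS1 : 0 ≤ S := tsum_nonneg fun n => by
    have : 0 ≤ ∫ s, ‖q s‖ := integral_nonneg fun _ => norm_nonneg _
    positivity
  obtain ⟨R, hR⟩ := exists_norm_volterra_one_le (integrable_neg_conj hq)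
    (ε := ε / (S + 1)) (by positivity)
  refine ⟨R, fun ξ hξ hRξ t => ?_⟩
  have h := norm_jost_sub_le hq hξ (δ := ε / (S + 1)) (by positivity) (hR ξ hξ hRξ) t
  have h2 : ε / (S + 1) * S ≤ ε := by
    rw [div_mul_eq_mul_div, div_le_iff₀ (by positivity)]
    nlinarith
  exact ⟨h.1.trans h2, h.2.trans h2⟩

lemma tendsto_jost_atBot (hq : Integrable q) {ξ : ℂ} (hξ : 0 ≤ ξ.im) :
    Tendsto (jostX q ξ) atBot (𝓝 1) ∧ Tendsto (jostY q ξ) atBot (𝓝 0) := by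
  set S := ∑' n : ℕ, (∫ s, ‖q s‖) ^ n / n.factorial with hS
  have hS0 : 0 ≤ S := tsum_nonneg fun n => by
    have : 0 ≤ ∫ s, ‖q s‖ := integral_nonneg fun _ => norm_nonneg _
    positivity
  have hv : ∀ {ζ : ℂ} {p f : ℝ → ℂ}, 0 ≤ ζ.im → (∀ s, ‖p s‖ = ‖q s‖) → (∀ s, ‖f s‖ ≤ S) →
      Tendsto (volterra ζ p f) atBot (𝓝 0) := by
    intro ζ p f hζ hp hf
    refine squeeze_zero_norm (a := fun t => S * massUpTo q t) (fun t => ?_) ?_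
    · simpa using norm_volterra_le hq hζ hp (C := S) (n := 0) (by simpa using hf) hS0 t
    · simpa using (tendsto_massUpTo_atBot hq).const_mul S
  constructor
  · rw [funext (jostX_eq hq hξ)]
    simpa using (hv (ζ := 0) (by simp) (fun _ => rfl) (norm_jostY_le hq hξ)).const_add 1
  · rw [funext (jostY_eq hq hξ)]
    exact hv hξ (fun _ => by simp) (norm_jostX_le hq hξ)

lemma jostTerm_regular (hq : Integrable q) (n : ℕ) (t : ℝ) :
    (DifferentiableOn ℂ (fun ξ => (jostTerm q ξ n).1 t) {z : ℂ | 0 < z.im} ∧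
      DifferentiableOn ℂ (fun ξ => (jostTerm q ξ n).2 t) {z : ℂ | 0 < z.im}) ∧
    (ContinuousOn (fun ξ => (jostTerm q ξ n).1 t) {z : ℂ | 0 ≤ z.im} ∧
      ContinuousOn (fun ξ => (jostTerm q ξ n).2 t) {z : ℂ | 0 ≤ z.im}) := by
  induction n generalizing t with
  | zero =>
    exact ⟨⟨differentiableOn_const _, differentiableOn_const _⟩,
      ⟨continuousOn_const, continuousOn_const⟩⟩
  | succ n ih =>
    refine ⟨⟨?_, ?_⟩, ⟨?_, ?_⟩⟩
    · exact differentiableOn_volterra (κ := fun _ => 0) (differentiable_const _) (by simp) hq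
        (fun z hz => continuous_jostTerm_snd hq hz n) (fun z hz => norm_jostTerm_snd_le hq hz n)
        (fun s => (ih s).1.2) t
    · exact differentiableOn_volterra (κ := id) differentiable_id (by simp)
        (integrable_neg_conj hq)
        (fun z hz => continuous_jostTerm_fst hq hz n) (fun z hz => norm_jostTerm_fst_le hq hz n)
        (fun s => (ih s).1.1) t
    · exact continuousOn_volterra (κ := fun _ => 0) continuous_const (by simp) hq
        (fun z hz => continuous_jostTerm_snd hq hz n) (fun z hz => norm_jostTerm_snd_le hq hz n)
        (fun s => (ih s).2.2) t
    · exact continuousOn_volterra (κ := id) continuous_id (by simp) (integrable_neg_conj hq)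
        (fun z hz => continuous_jostTerm_fst hq hz n) (fun z hz => norm_jostTerm_fst_le hq hz n)
        (fun s => (ih s).2.1) t

lemma differentiableOn_jostX (hq : Integrable q) (t : ℝ) :
    DifferentiableOn ℂ (fun ξ => jostX q ξ t) {z : ℂ | 0 < z.im} :=
  Complex.differentiableOn_tsum_of_summable_norm (summable_mass q)
    (fun n => (jostTerm_regular hq n t).1.1) isOpen_im_pos
    fun n _ hz => norm_jostTerm_fst_le hq (le_of_lt hz) n t

lemma differentiableOn_jostY (hq : Integrable q) (t : ℝ) :
    DifferentiableOn ℂ (fun ξ => jostY q ξ t) {z : ℂ | 0 < z.im} :=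
  Complex.differentiableOn_tsum_of_summable_norm (summable_mass q)
    (fun n => (jostTerm_regular hq n t).1.2) isOpen_im_pos
    fun n _ hz => norm_jostTerm_snd_le hq (le_of_lt hz) n t

lemma continuousOn_jostX (hq : Integrable q) (t : ℝ) :
    ContinuousOn (fun ξ => jostX q ξ t) {z : ℂ | 0 ≤ z.im} :=
  continuousOn_tsum (fun n => (jostTerm_regular hq n t).2.1) (summable_mass q)
    fun n _ hz => norm_jostTerm_fst_le hq hz n t

lemma continuousOn_jostY (hq : Integrable q) (t : ℝ) :
    ContinuousOn (fun ξ => jostY q ξ t) {z : ℂ | 0 ≤ z.im} :=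
  continuousOn_tsum (fun n => (jostTerm_regular hq n t).2.2) (summable_mass q)
    fun n _ hz => norm_jostTerm_snd_le hq hz n t

lemma tendsto_nhdsWithin_ofReal_of_continuousOn {f : ℂ → ℂ}
    (hf : ContinuousOn f {z : ℂ | 0 ≤ z.im}) (x : ℝ) :
    Tendsto f (𝓝[{z : ℂ | 0 < z.im}] (x : ℂ)) (𝓝 (f x)) :=
  (hf x (by simp)).tendsto.mono_left (nhdsWithin_mono _ fun z (hz : 0 < z.im) => hz.le)

lemma tendsto_jost_cobounded (hq : Integrable q) (t : ℝ) :
    Tendsto (fun ξ => jostX q ξ t) (Bornology.cobounded ℂ ⊓ 𝓟 {z : ℂ | 0 < z.im}) (𝓝 1) ∧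
      Tendsto (fun ξ => jostY q ξ t) (Bornology.cobounded ℂ ⊓ 𝓟 {z : ℂ | 0 < z.im}) (𝓝 0) := by
  have hev : ∀ ε > 0, ∀ᶠ ξ in Bornology.cobounded ℂ ⊓ 𝓟 {z : ℂ | 0 < z.im},
      ‖jostX q ξ t - 1‖ ≤ ε ∧ ‖jostY q ξ t‖ ≤ ε := by
    intro ε hε
    obtain ⟨R, hR⟩ := exists_norm_jost_sub_le hq hε
    have h1 : ∀ᶠ ξ : ℂ in Bornology.cobounded ℂ, R ≤ ‖ξ‖ :=
      tendsto_norm_cobounded_atTop.eventually (eventually_ge_atTop R)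
    refine eventually_inf_principal.2 (h1.mono fun ξ h2 h3 => ?_)
    exact hR ξ (le_of_lt h3) h2 t
  constructor
  · refine Metric.nhds_basis_closedBall.tendsto_right_iff.2 fun ε hε => ?_
    filter_upwards [hev ε hε] with ξ h
    rw [mem_closedBall_iff_norm]
    exact h.1
  · refine Metric.nhds_basis_closedBall.tendsto_right_iff.2 fun ε hε => ?_
    filter_upwards [hev ε hε] with ξ h
    rw [mem_closedBall_zero_iff]
    exact h.2

end Jost

/-! ### Conservation laws of the Jost solution -/

section Identities
variable {q : ℝ → ℂ}

lemma norm_sq_eq_mul_conj_re (z : ℂ) : ‖z‖ ^ 2 = (z * (starRingEnd ℂ) z).re := by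
  rw [Complex.mul_conj, Complex.ofReal_re, Complex.normSq_eq_norm_sq]

/-- The energy identity of the Jost solution. -/
lemma norm_sq_jost_sub (hq : Integrable q) {ξ : ℂ} (hξ : 0 ≤ ξ.im) (a b : ℝ) :
    (‖jostX q ξ a‖ ^ 2 + ‖jostY q ξ a‖ ^ 2) - (‖jostX q ξ b‖ ^ 2 + ‖jostY q ξ b‖ ^ 2) =
      4 * ξ.im * ∫ t in a..b, ‖jostY q ξ t‖ ^ 2 := by
  have hX := isACPrimitive_jostX hq hξ
  have hY := isACPrimitive_jostY hq hξ
  have h := ((hX.mul hX.conj).add (hY.mul hY.conj)).re_sub a b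
  simp only [Complex.add_re, ← norm_sq_eq_mul_conj_re] at h
  rw [← neg_sub, h, ← intervalIntegral.integral_const_mul, ← intervalIntegral.integral_neg]
  congr 1
  ext t
  rw [norm_sq_eq_mul_conj_re]
  simp
  ring

/-- The potential cancels from the total energy identity; keeping |Y|² separate retains its coupling
to q, which the upper bound on η(1 - |X|²) uses. -/
lemma norm_sq_jostY_sub (hq : Integrable q) {ξ : ℂ} (hξ : 0 ≤ ξ.im) (a b : ℝ) :
    ‖jostY q ξ b‖ ^ 2 - ‖jostY q ξ a‖ ^ 2 = ∫ t in a..b,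
      (-(4 * ξ.im * ‖jostY q ξ t‖ ^ 2) -
        2 * (q t * jostY q ξ t * (starRingEnd ℂ) (jostX q ξ t)).re) := by
  have hY := isACPrimitive_jostY hq hξ
  have h := (hY.mul hY.conj).re_sub a b
  simp only [← norm_sq_eq_mul_conj_re] at h
  rw [h]
  congr 1
  ext t
  rw [norm_sq_eq_mul_conj_re]
  simp
  ring

lemma tendsto_norm_sq_jost (hq : Integrable q) {ξ : ℂ} (hξ : 0 ≤ ξ.im) :
    Tendsto (fun t => ‖jostX q ξ t‖ ^ 2 + ‖jostY q ξ t‖ ^ 2) atBot (𝓝 1) := by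
  obtain ⟨h1, h2⟩ := tendsto_jost_atBot hq hξ
  simpa using (h1.norm.pow 2).add (h2.norm.pow 2)

/-- The energy is nonincreasing in time for Im ξ ≥ 0 and equals 1 in the limit at -∞. -/
lemma norm_sq_jost_le_one (hq : Integrable q) {ξ : ℂ} (hξ : 0 ≤ ξ.im) (t : ℝ) :
    ‖jostX q ξ t‖ ^ 2 + ‖jostY q ξ t‖ ^ 2 ≤ 1 := by
  refine ge_of_tendsto (tendsto_norm_sq_jost hq hξ) ?_
  filter_upwards [eventually_le_atBot t] with a ha
  have h := norm_sq_jost_sub hq hξ a t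
  have h1 : 0 ≤ ∫ t in a..t, ‖jostY q ξ t‖ ^ 2 :=
    intervalIntegral.integral_nonneg ha fun _ _ => by positivity
  have : 0 ≤ 4 * ξ.im * ∫ t in a..t, ‖jostY q ξ t‖ ^ 2 := by positivity
  linarith

lemma norm_jostX_le_one (hq : Integrable q) {ξ : ℂ} (hξ : 0 ≤ ξ.im) (t : ℝ) :
    ‖jostX q ξ t‖ ≤ 1 := by
  have := norm_sq_jost_le_one hq hξ t
  nlinarith [sq_nonneg ‖jostY q ξ t‖, norm_nonneg (jostX q ξ t)]

lemma integral_norm_sq_jostY_le (hq : Integrable q) {ξ : ℂ} (hξ : 0 ≤ ξ.im) (a b : ℝ) :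
    4 * ξ.im * ∫ t in a..b, ‖jostY q ξ t‖ ^ 2 ≤ 1 - ‖jostX q ξ b‖ ^ 2 := by
  rw [← norm_sq_jost_sub hq hξ a b]
  have := norm_sq_jost_le_one hq hξ a
  nlinarith [sq_nonneg ‖jostY q ξ b‖]

lemma norm_sq_jost_ofReal (hq : Integrable q) (ξ : ℝ) (t : ℝ) :
    ‖jostX q ξ t‖ ^ 2 + ‖jostY q ξ t‖ ^ 2 = 1 := by
  have hξ : 0 ≤ (ξ : ℂ).im := by simp
  refine tendsto_nhds_unique (f := fun _ : ℝ => ‖jostX q ξ t‖ ^ 2 + ‖jostY q ξ t‖ ^ 2) (l := atBot)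
    tendsto_const_nhds ?_
  refine (tendsto_norm_sq_jost hq hξ).congr fun a => ?_
  have h := norm_sq_jost_sub hq hξ a t
  rw [Complex.ofReal_im, mul_zero, zero_mul] at h
  linarith

/-- The energy N satisfies N' = -4 Im ξ |Y|² ≥ -4 Im ξ N, so exp(4 Im ξ t) N is nondecreasing, and
it is positive near -∞. Hence X and Y have no common zero. -/
lemma norm_sq_jost_pos (hq : Integrable q) {ξ : ℂ} (hξ : 0 ≤ ξ.im) (t : ℝ) :
    0 < ‖jostX q ξ t‖ ^ 2 + ‖jostY q ξ t‖ ^ 2 := by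
  set N := fun t => ‖jostX q ξ t‖ ^ 2 + ‖jostY q ξ t‖ ^ 2 with hN
  have hYc : Continuous fun t => ‖jostY q ξ t‖ ^ 2 := (continuous_jostY hq hξ).norm.pow 2
  have hder : ∀ t, HasDerivAt N (-(4 * ξ.im * ‖jostY q ξ t‖ ^ 2)) t := by
    intro t
    have h1 : N = fun t => N 0 - 4 * ξ.im * ∫ s in (0 : ℝ)..t, ‖jostY q ξ s‖ ^ 2 := by
      ext t
      rw [← norm_sq_jost_sub hq hξ 0 t]
      simp only [hN]
      ring
    rw [h1]
    exact ((hYc.integral_hasStrictDerivAt 0 t).hasDerivAt.const_mul _).const_sub _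
  have hmono : Monotone fun t => Real.exp (4 * ξ.im * t) * N t := by
    have hd : ∀ t, HasDerivAt (fun t => Real.exp (4 * ξ.im * t) * N t)
        (Real.exp (4 * ξ.im * t) * (4 * ξ.im * ‖jostX q ξ t‖ ^ 2)) t := by
      intro t
      refine ((((hasDerivAt_id t).const_mul (4 * ξ.im)).exp).mul (hder t)).congr_deriv ?_
      simp only [hN, id]
      ring
    refine monotone_of_deriv_nonneg (fun t => (hd t).differentiableAt) fun t => ?_
    rw [(hd t).deriv]
    positivity
  obtain ⟨a, ha0, hat⟩ := (((tendsto_norm_sq_jost hq hξ).eventually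
    (lt_mem_nhds (show (0 : ℝ) < 1 by norm_num))).and (eventually_le_atBot t)).exists
  have h1 := hmono hat
  have h2 : 0 < Real.exp (4 * ξ.im * a) * N a := mul_pos (Real.exp_pos _) ha0
  exact pos_of_mul_pos_right (h2.trans_le h1) (Real.exp_pos _).le

end Identities

/-! ### From the Bloch equation to the spinor system -/

section Bloch
variable {ω : ℝ → ℂ} {z : ℝ} {m : ℝ → Fin 3 → ℝ}

/-- The Bloch equation, in the complex coordinates `m₁ + i m₂` and `m₃`. -/
lemma isACPrimitive_of_isBlochSolution (hω : Integrable ω) (hm : IsBlochSolution ω z m) :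
    IsACPrimitive (fun t => (m t 0 : ℂ) + Complex.I * m t 1)
      (fun t => -Complex.I * z * ((m t 0 : ℂ) + Complex.I * m t 1) +
        Complex.I * ω t * m t 2) ∧
    IsACPrimitive (fun t => (m t 2 : ℂ))
      (fun t => -Complex.I / 2 * ((starRingEnd ℂ) ((m t 0 : ℂ) + Complex.I * m t 1) * ω t -
        ((m t 0 : ℂ) + Complex.I * m t 1) * (starRingEnd ℂ) (ω t))) := by
  obtain ⟨hc, hint⟩ := hm
  have hci : ∀ i, Continuous fun t => m t i := fun i => (continuous_apply i).comp hc
  have hr : ∀ a b, IntervalIntegrable (fun t => (ω t).re) volume a b := fun a b =>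
    hω.re.intervalIntegrable
  have hi : ∀ a b, IntervalIntegrable (fun t => (ω t).im) volume a b := fun a b =>
    hω.im.intervalIntegrable
  have hmr : ∀ i a b, IntervalIntegrable (fun t => m t i * (ω t).re) volume a b := fun i a b =>
    (hr a b).continuousOn_mul (hci i).continuousOn
  have hmi : ∀ i a b, IntervalIntegrable (fun t => m t i * (ω t).im) volume a b := fun i a b =>
    (hi a b).continuousOn_mul (hci i).continuousOn
  have hmz : ∀ i a b, IntervalIntegrable (fun t => m t i * z) volume a b := fun i a b =>
    ((hci i).mul continuous_const).intervalIntegrable a b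
  have hcomp : ∀ a b i, IntervalIntegrable
      (fun τ => (m τ ⨯₃ ![(ω τ).re, (ω τ).im, z]) i) volume a b := by
    intro a b i
    fin_cases i
    · simpa [cross_apply] using (hmz 1 a b).sub (hmi 2 a b)
    · simpa [cross_apply] using (hmr 2 a b).sub (hmz 0 a b)
    · simpa [cross_apply] using (hmi 0 a b).sub (hmr 1 a b)
  have hvec : ∀ a b, IntervalIntegrable
      (fun τ => m τ ⨯₃ ![(ω τ).re, (ω τ).im, z]) volume a b := fun a b =>
    ⟨Integrable.of_eval fun i => (hcomp a b i).1, Integrable.of_eval fun i => (hcomp a b i).2⟩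
  have hev : ∀ i a b, m b i - m a i =
      ∫ τ in a..b, (m τ ⨯₃ ![(ω τ).re, (ω τ).im, z]) i := by
    intro i a b
    have h := (ContinuousLinearMap.proj (R := ℝ) (φ := fun _ : Fin 3 => ℝ)
      i).intervalIntegral_comp_comm (hvec a b)
    simp only [ContinuousLinearMap.proj_apply] at h
    rw [h, ← hint a b, Pi.sub_apply]
  have hωi : ∀ a b, IntervalIntegrable ω volume a b := fun a b => hω.intervalIntegrable
  have hωc : ∀ a b, IntervalIntegrable (fun t => (starRingEnd ℂ) (ω t)) volume a b := fun a b =>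
    ((Complex.conjCLE : ℂ →L[ℝ] ℂ).integrable_comp hω).intervalIntegrable
  constructor
  · refine IsACPrimitive.mk_re_im (fun a b => ?_) (fun a b => ?_) (fun a b => ?_)
    · refine IntervalIntegrable.add (Continuous.intervalIntegrable ?_ a b) ?_
      · have := hci 0; have := hci 1; fun_prop
      · refine IntervalIntegrable.mul_continuousOn ((hωi a b).const_mul _) ?_
        have := hci 2; fun_prop
    · have h := hev 0 a b
      simp only [cross_apply] at h
      simpa [mul_comm, sub_eq_add_neg] using h
    · have h := hev 1 a b
      simp only [cross_apply] at h
      have h2 : ∀ t, (-Complex.I * z * ((m t 0 : ℂ) + Complex.I * m t 1) +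
          Complex.I * ω t * m t 2).im = m t 2 * (ω t).re - m t 0 * z := fun t => by
        simp; ring
      simp only [h2]
      simpa using h
  · refine IsACPrimitive.mk_re_im (fun a b => ?_) (fun a b => ?_) (fun a b => ?_)
    · refine IntervalIntegrable.const_mul (IntervalIntegrable.sub ?_ ?_) _
      · refine (hωi a b).continuousOn_mul ?_
        refine Continuous.continuousOn (Complex.continuous_conj.comp ?_)
        have := hci 0; have := hci 1; fun_prop
      · refine (hωc a b).continuousOn_mul ?_
        have := hci 0; have := hci 1; fun_prop
    · have h := hev 2 a b
      simp only [cross_apply] at h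
      have h2 : ∀ t, (-Complex.I / 2 * ((starRingEnd ℂ) ((m t 0 : ℂ) + Complex.I * m t 1) * ω t -
        ((m t 0 : ℂ) + Complex.I * m t 1) * (starRingEnd ℂ) (ω t))).re =
          m t 0 * (ω t).im - m t 1 * (ω t).re := fun t => by
        simp; ring
      simp only [h2]
      simpa using h
    · simp

/-- The potential of the spinor system that corresponds to the pulse `ω`. -/
def spinorPotential (ω : ℝ → ℂ) (t : ℝ) : ℂ := -Complex.I / 2 * ω t

lemma integrable_spinorPotential (hω : Integrable ω) : Integrable (spinorPotential ω) :=
  hω.const_mul _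

/-- The Bloch solution is the quadratic image of the Jost solution. -/
theorem bloch_eq_jost (hω : Integrable ω) {ξ : ℝ} (hm : IsBlochSolution ω (2 * ξ) m)
    (hlim : Tendsto m atBot (𝓝 ![0, 0, 1])) (t : ℝ) :
    (m t 0 : ℂ) + Complex.I * m t 1 =
      2 * (jostX (spinorPotential ω) ξ t *
        (starRingEnd ℂ) (jostY (spinorPotential ω) ξ t)) ∧
    (m t 2 : ℂ) = ‖jostX (spinorPotential ω) ξ t‖ ^ 2 - ‖jostY (spinorPotential ω) ξ t‖ ^ 2 := by
  set q := spinorPotential ω with hq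
  have hqi : Integrable q := integrable_spinorPotential hω
  have hξ : 0 ≤ (ξ : ℂ).im := by simp
  have hX := isACPrimitive_jostX hqi hξ
  have hY := isACPrimitive_jostY hqi hξ
  obtain ⟨hu, hw⟩ := isACPrimitive_of_isBlochSolution hω hm
  -- The differences D and V between the Bloch solution and the quadratic expressions solve the same
  -- equation. Its flow is a rotation, so |D|² + V² is constant; its limit at -∞ is 0.
  have hU := (hX.mul hY.conj).const_mul (-2)
  have hW := ((hX.mul hX.conj).const_mul (-1)).add (hY.mul hY.conj)
  have hD := hu.add hU
  have hV := hw.add hW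
  have hE := (hD.mul hD.conj).add (hV.mul hV)
  have hconst : ∀ a b, ‖(m b 0 : ℂ) + Complex.I * m b 1 + -2 *
      (jostX q ξ b * (starRingEnd ℂ) (jostY q ξ b))‖ ^ 2 +
      (m b 2 - ‖jostX q ξ b‖ ^ 2 + ‖jostY q ξ b‖ ^ 2) ^ 2 =
      ‖(m a 0 : ℂ) + Complex.I * m a 1 + -2 *
      (jostX q ξ a * (starRingEnd ℂ) (jostY q ξ a))‖ ^ 2 +
      (m a 2 - ‖jostX q ξ a‖ ^ 2 + ‖jostY q ξ a‖ ^ 2) ^ 2 := by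
    intro a b
    have h := hE.2 a b
    rw [intervalIntegral.integral_congr (g := fun _ => 0)] at h
    · rw [intervalIntegral.integral_zero, sub_eq_zero] at h
      simp only [Complex.mul_conj, Complex.normSq_eq_norm_sq] at h
      have h' := congrArg Complex.re h
      have hre : ∀ x y v n : ℝ, ((n : ℂ) + ((v : ℂ) + (-1 * (x : ℂ) + y)) *
          ((v : ℂ) + (-1 * (x : ℂ) + y))).re = n + (v - x + y) ^ 2 := by
        intro x y v n
        have h3 : (n : ℂ) + ((v : ℂ) + (-1 * (x : ℂ) + y)) * ((v : ℂ) + (-1 * (x : ℂ) + y)) =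
            ((n + (v - x + y) ^ 2 : ℝ) : ℂ) := by push_cast; ring
        rw [h3, Complex.ofReal_re]
      rwa [hre, hre] at h'
    · intro t _
      simp only [hq, spinorPotential, map_add, map_sub, map_mul, map_neg, map_div₀,
        Complex.conj_ofReal, Complex.conj_conj, Complex.conj_I, map_ofNat]
      push_cast
      ring
  obtain ⟨hX1, hY1⟩ := tendsto_jost_atBot hqi hξ
  have hmi : ∀ i, Tendsto (fun t => m t i) atBot (𝓝 ((![0, 0, 1] : Fin 3 → ℝ) i)) := fun i =>
    ((continuous_apply i).tendsto _).comp hlim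
  have hmC : ∀ i, Tendsto (fun t => (m t i : ℂ)) atBot
      (𝓝 (((![0, 0, 1] : Fin 3 → ℝ) i : ℝ) : ℂ)) := fun i =>
    (Complex.continuous_ofReal.tendsto _).comp (hmi i)
  have hYc : Tendsto (fun t => (starRingEnd ℂ) (jostY q ξ t)) atBot (𝓝 ((starRingEnd ℂ) 0)) :=
    (Complex.continuous_conj.tendsto _).comp hY1
  have hlim0 := (((((hmC 0).add ((hmC 1).const_mul Complex.I)).add
    ((hX1.mul hYc).const_mul (-2))).norm.pow 2).add
    ((((hmi 2).sub (hX1.norm.pow 2)).add (hY1.norm.pow 2)).pow 2))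
  have hzero := tendsto_nhds_unique (tendsto_const_nhds.congr fun a => hconst a t) hlim0
  simp at hzero
  have h1 := sq_nonneg ‖(m t 0 : ℂ) + Complex.I * m t 1 + -(2 *
      (jostX q ξ t * (starRingEnd ℂ) (jostY q ξ t)))‖
  have h2 := sq_nonneg (m t 2 - ‖jostX q ξ t‖ ^ 2 + ‖jostY q ξ t‖ ^ 2)
  have h3 : ‖(m t 0 : ℂ) + Complex.I * m t 1 + -(2 *
      (jostX q ξ t * (starRingEnd ℂ) (jostY q ξ t)))‖ ^ 2 = 0 := by linarith
  have h4 : (m t 2 - ‖jostX q ξ t‖ ^ 2 + ‖jostY q ξ t‖ ^ 2) ^ 2 = 0 := by linarith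
  constructor
  · have := norm_eq_zero.1 (pow_eq_zero_iff two_ne_zero |>.1 h3)
    linear_combination this
  · have := pow_eq_zero_iff two_ne_zero |>.1 h4
    exact_mod_cast (by linarith : m t 2 = ‖jostX q ξ t‖ ^ 2 - ‖jostY q ξ t‖ ^ 2)

end Bloch

/-! ### The reflection coefficient -/

section Reflection
variable {ω : ℝ → ℂ} {M : ℝ → Fin 3 → ℝ} {ρ : ℝ}

/-- After ρ the potential is zero almost everywhere, leaving X' = 0 and Y' = 2iξY; the exponential
factor undoes this rotation. -/
lemma jost_eq_of_rephasing (hω : Integrable ω) (hρ : HasRephasingTime ω ρ) {ξ : ℂ}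
    (hξ : 0 ≤ ξ.im) {t : ℝ} (ht : ρ ≤ t) :
    jostX (spinorPotential ω) ξ t = jostX (spinorPotential ω) ξ ρ ∧
    Complex.exp (-2 * Complex.I * ξ * t) * jostY (spinorPotential ω) ξ t =
      Complex.exp (-2 * Complex.I * ξ * ρ) * jostY (spinorPotential ω) ξ ρ := by
  have hqi := integrable_spinorPotential hω
  have hX := isACPrimitive_jostX hqi hξ
  have hY := (IsACPrimitive.exp_const_mul (-2 * Complex.I * ξ)).mul (isACPrimitive_jostY hqi hξ)
  have hzero : ∀ {f : ℝ → ℂ}, (∀ s, ω s = 0 → f s = 0) → ∫ s in ρ..t, f s = 0 := by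
    intro f hf
    rw [intervalIntegral.integral_of_le ht]
    refine integral_eq_zero_of_ae ?_
    filter_upwards [ae_restrict_mem measurableSet_Ioc, ae_restrict_of_ae hρ] with s hs h
    exact hf s (h hs.1)
  constructor
  · have h := hX.2 ρ t
    rw [hzero fun s hs => by simp [spinorPotential, hs]] at h
    exact sub_eq_zero.1 h
  · have h := hY.2 ρ t
    rw [hzero fun s hs => by simp [spinorPotential, hs]; ring] at h
    exact sub_eq_zero.1 h

/-- The reflection coefficient is the quotient of the components of the Jost solution. -/
theorem reflectionCoefficient_eq (hω : Integrable ω) (hρ : HasRephasingTime ω ρ)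
    (hT : IsSelectiveExcitation ω M) (hMz : ∀ z, M z 2 ≠ -1) (ξ : ℝ) :
    jostX (spinorPotential ω) ξ ρ ≠ 0 ∧ reflectionCoefficient M ξ =
      Complex.exp (-2 * Complex.I * ξ * ρ) *
        (jostY (spinorPotential ω) ξ ρ / jostX (spinorPotential ω) ξ ρ) := by
  obtain ⟨m, hm, hlim, hM⟩ := hT (2 * ξ)
  have hξ : 0 ≤ (ξ : ℂ).im := by simp
  have hqi := integrable_spinorPotential hω
  set x := jostX (spinorPotential ω) ξ ρ with hx
  set y := jostY (spinorPotential ω) ξ ρ with hy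
  have hnorm : ‖x‖ ^ 2 + ‖y‖ ^ 2 = 1 := norm_sq_jost_ofReal hqi ξ ρ
  have hcoord : ∀ i, Tendsto (fun t : ℝ => (zRotation (2 * ξ * t) *ᵥ m t) i) atTop
      (𝓝 (M (2 * ξ) i)) := fun i => ((continuous_apply i).tendsto _).comp hM
  have hM2 : M (2 * ξ) 2 = ‖x‖ ^ 2 - ‖y‖ ^ 2 := by
    refine tendsto_nhds_unique (hcoord 2) (tendsto_const_nhds.congr' ?_)
    filter_upwards [eventually_ge_atTop ρ] with t ht
    obtain ⟨h1, h2⟩ := jost_eq_of_rephasing hω hρ hξ ht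
    have h3 := (bloch_eq_jost hω hm hlim t).2
    have h4 : m t 2 = ‖jostX (spinorPotential ω) ξ t‖ ^ 2 -
      ‖jostY (spinorPotential ω) ξ t‖ ^ 2 := by exact_mod_cast h3
    have h5 := norm_sq_jost_ofReal hqi ξ t
    have h6 : (zRotation (2 * ξ * t) *ᵥ m t) 2 = m t 2 := by
      simp [zRotation, Matrix.mulVec, dotProduct, Fin.sum_univ_three]
    rw [h6, h4]
    rw [h1] at h5 ⊢
    rw [← hx] at h5 ⊢
    linarith
  -- The rotating frame multiplies m₁ + i m₂ = 2XȲ by exp(2iξt), the conjugate of the factor that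
  -- freezes Y. The expression is therefore constant for t ≥ ρ.
  have hM01 : (M (2 * ξ) 0 : ℂ) + Complex.I * M (2 * ξ) 1 =
      2 * (x * (starRingEnd ℂ) (Complex.exp (-2 * Complex.I * ξ * ρ) * y)) := by
    have hl : Tendsto (fun t : ℝ => (((zRotation (2 * ξ * t) *ᵥ m t) 0 : ℝ) : ℂ) +
        Complex.I * (((zRotation (2 * ξ * t) *ᵥ m t) 1 : ℝ) : ℂ)) atTop
        (𝓝 ((M (2 * ξ) 0 : ℂ) + Complex.I * M (2 * ξ) 1)) :=
      ((Complex.continuous_ofReal.tendsto _).comp (hcoord 0)).add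
        (((Complex.continuous_ofReal.tendsto _).comp (hcoord 1)).const_mul _)
    refine tendsto_nhds_unique hl (tendsto_const_nhds.congr' ?_)
    filter_upwards [eventually_ge_atTop ρ] with t ht
    obtain ⟨h1, h2⟩ := jost_eq_of_rephasing hω hρ hξ ht
    have h3 := (bloch_eq_jost hω hm hlim t).1
    rw [← h2, map_mul, ← Complex.exp_conj, hx, ← h1]
    have h4 : (((zRotation (2 * ξ * t) *ᵥ m t) 0 : ℝ) : ℂ) +
        Complex.I * (((zRotation (2 * ξ * t) *ᵥ m t) 1 : ℝ) : ℂ) =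
        Complex.exp (2 * Complex.I * ξ * t) * ((m t 0 : ℂ) + Complex.I * m t 1) := by
      have h5 : Complex.exp (2 * Complex.I * ξ * t) =
          Complex.cos (2 * ξ * t) + Complex.sin (2 * ξ * t) * Complex.I := by
        rw [← Complex.exp_mul_I]
        ring_nf
      rw [h5]
      simp [zRotation, Matrix.mulVec, dotProduct, Fin.sum_univ_three]
      linear_combination -(Complex.sin (2 * ξ * t)) * m t 1 * Complex.I_sq
    rw [h4, h3]
    simp only [map_mul, map_neg, map_ofNat, Complex.conj_I, Complex.conj_ofReal]
    ring_nf
  have hx0 : x ≠ 0 := by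
    intro h0
    apply hMz (2 * ξ)
    rw [h0] at hnorm hM2
    rw [norm_zero] at hnorm hM2
    linarith
  refine ⟨hx0, ?_⟩
  -- By |x|² + |y|² = 1, the denominator is 2|x|², which cancels the conjugate of x in the
  -- numerator.
  have hden : (1 + (M (2 * ξ) 2 : ℂ)) = 2 * (x * (starRingEnd ℂ) x) := by
    rw [hM2, Complex.mul_conj, Complex.normSq_eq_norm_sq]
    norm_cast
    linarith
  have hnum : (M (2 * ξ) 0 : ℂ) - Complex.I * M (2 * ξ) 1 =
      2 * ((starRingEnd ℂ) x * (Complex.exp (-2 * Complex.I * ξ * ρ) * y)) := by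
    have h := congrArg (starRingEnd ℂ) hM01
    simp only [map_add, map_mul, Complex.conj_ofReal, Complex.conj_I, map_ofNat,
      Complex.conj_conj] at h
    rw [← h, map_mul] at *
    ring
  have hxc : (starRingEnd ℂ) x ≠ 0 := (map_ne_zero _).2 hx0
  rw [reflectionCoefficient, hnum, hden]
  field_simp

end Reflection

/-! ### The two inequalities between η(1 - |X|²) and the energy -/

section Energy
variable {q : ℝ → ℂ} {ρ : ℝ}

/-- The upper bound in the energy identity for large imaginary frequencies. -/
lemma mul_one_sub_norm_sq_jostX_le (hq : Integrable q) (hq2 : Integrable fun t => ‖q t‖ ^ 2)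
    {η : ℝ} (hη : 0 < η) (t : ℝ) :
    η * (1 - ‖jostX q (Complex.I * η) t‖ ^ 2) ≤ ∫ s, ‖q s‖ ^ 2 := by
  have hξ : (Complex.I * η : ℂ).im = η := by simp
  have hξ0 : 0 ≤ (Complex.I * η : ℂ).im := by rw [hξ]; exact hη.le
  set X := jostX q (Complex.I * η) with hX
  set Y := jostY q (Complex.I * η) with hY
  have hXc : Continuous X := continuous_jostX hq hξ0
  have hYc : Continuous Y := continuous_jostY hq hξ0
  -- The combination |X|² + |Y|² - 2|Y|² results from adding the total energy identity to twice the
  -- inequality for |Y|².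
  have hlim : Tendsto (fun a => ‖X a‖ ^ 2 + ‖Y a‖ ^ 2 - 2 * ‖Y a‖ ^ 2) atBot (𝓝 (1 - 2 * 0)) := by
    refine (tendsto_norm_sq_jost hq hξ0).sub (Tendsto.const_mul 2 ?_)
    simpa using (tendsto_jost_atBot hq hξ0).2.norm.pow 2
  have key : ∀ᶠ a in atBot, ‖X a‖ ^ 2 + ‖Y a‖ ^ 2 - 2 * ‖Y a‖ ^ 2 ≤
      (∫ s, ‖q s‖ ^ 2) / η + ‖X t‖ ^ 2 := by
    filter_upwards [eventually_le_atBot t] with a ha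
    have h1 := norm_sq_jost_sub hq hξ0 a t
    have h2 := norm_sq_jostY_sub hq hξ0 a t
    rw [← hX, ← hY, hξ] at h1 h2
    have hYi : IntervalIntegrable (fun s => ‖Y s‖ ^ 2) volume a t :=
      (hYc.norm.pow 2).intervalIntegrable a t
    have hq2i : IntervalIntegrable (fun s => ‖q s‖ ^ 2) volume a t := hq2.intervalIntegrable
    have hqYX : IntervalIntegrable (fun s => (q s * Y s * (starRingEnd ℂ) (X s)).re)
        volume a t := by
      refine IsACPrimitive.intervalIntegrable_re ?_
      have h3 : IntervalIntegrable (fun s => q s * Y s) volume a t :=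
        hq.intervalIntegrable.mul_continuousOn hYc.continuousOn
      exact h3.mul_continuousOn (Complex.continuous_conj.comp hXc).continuousOn
    have h4 : ∫ s in a..t, (-(4 * η * ‖Y s‖ ^ 2) -
        2 * (q s * Y s * (starRingEnd ℂ) (X s)).re) ≤
        ∫ s in a..t, (1 / (2 * η) * ‖q s‖ ^ 2 - 2 * η * ‖Y s‖ ^ 2) := by
      refine intervalIntegral.integral_mono_on ha ?_ ?_ fun s _ => ?_
      · exact ((hYi.const_mul (4 * η)).neg).sub (hqYX.const_mul 2)
      · exact (hq2i.const_mul _).sub (hYi.const_mul _)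
      · have h5 : -(q s * Y s * (starRingEnd ℂ) (X s)).re ≤ ‖q s‖ * ‖Y s‖ := by
          refine (neg_le_abs _).trans ((Complex.abs_re_le_norm _).trans ?_)
          rw [norm_mul, norm_mul, RCLike.norm_conj]
          exact mul_le_of_le_one_right (by positivity) (norm_jostX_le_one hq hξ0 s)
        -- Young's inequality with weight 2η absorbs half of the dissipation 4η|Y|²; the other half
        -- is expressed by the energy identity.
        have h6 : 2 * (‖q s‖ * ‖Y s‖) ≤ 1 / (2 * η) * ‖q s‖ ^ 2 + 2 * η * ‖Y s‖ ^ 2 := by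
          have h7 : 0 ≤ 1 / (2 * η) * (‖q s‖ - 2 * η * ‖Y s‖) ^ 2 := by positivity
          have h8 : 1 / (2 * η) * (‖q s‖ - 2 * η * ‖Y s‖) ^ 2 =
              1 / (2 * η) * ‖q s‖ ^ 2 - 2 * (‖q s‖ * ‖Y s‖) + 2 * η * ‖Y s‖ ^ 2 := by
            field_simp
            ring
          linarith
        linarith
    rw [intervalIntegral.integral_sub (hq2i.const_mul _) (hYi.const_mul _),
      intervalIntegral.integral_const_mul, intervalIntegral.integral_const_mul] at h4
    have h9 : ∫ s in a..t, ‖q s‖ ^ 2 ≤ ∫ s, ‖q s‖ ^ 2 := by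
      rw [intervalIntegral.integral_of_le ha]
      exact setIntegral_le_integral hq2 (Eventually.of_forall fun _ => by positivity)
    have h10 : 1 / (2 * η) * ∫ s in a..t, ‖q s‖ ^ 2 ≤ (∫ s, ‖q s‖ ^ 2) / η / 2 := by
      calc _ ≤ 1 / (2 * η) * ∫ s, ‖q s‖ ^ 2 := by gcongr
        _ = _ := by field_simp
    nlinarith [sq_nonneg ‖Y t‖]
  have h := le_of_tendsto_of_tendsto hlim tendsto_const_nhds key
  have h2 : 1 - ‖X t‖ ^ 2 ≤ (∫ s, ‖q s‖ ^ 2) / η := by linarith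
  rw [le_div_iff₀ hη] at h2
  linarith

lemma sq_lintegral_le {α : Type*} [MeasurableSpace α] (μ : Measure α) {f : α → ENNReal}
    (hf : AEMeasurable f μ) : (∫⁻ x, f x ∂μ) ^ 2 ≤ μ Set.univ * ∫⁻ x, f x ^ 2 ∂μ := by
  have h := ENNReal.lintegral_mul_le_Lp_mul_Lq μ Real.HolderConjugate.two_two hf
    (aemeasurable_const (b := (1 : ENNReal)))
  simp only [Pi.mul_apply, mul_one, ENNReal.one_rpow, lintegral_const, one_mul] at h
  calc (∫⁻ x, f x ∂μ) ^ 2 ≤ ((∫⁻ x, f x ^ (2 : ℝ) ∂μ) ^ (1 / 2 : ℝ) * μ Set.univ ^ (1 / 2 : ℝ)) ^ 2 :=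
        pow_le_pow_left' h 2
    _ = μ Set.univ * ∫⁻ x, f x ^ 2 ∂μ := by
        rw [mul_pow, ← ENNReal.rpow_natCast, ← ENNReal.rpow_natCast, ← ENNReal.rpow_mul,
          ← ENNReal.rpow_mul]
        norm_num
        rw [mul_comm]

/-- The mean square of the increments of a primitive is bounded by the mean square. -/
lemma lintegral_sq_increment_le {f : ℝ → ℂ} (hf : Continuous f) {h : ℝ} (hh : 0 < h) :
    ∫⁻ t in Set.Iic (ρ - h), ‖∫ u in t..(t + h), f u‖ₑ ^ 2 ≤
      ENNReal.ofReal h ^ 2 * ∫⁻ u in Set.Iic ρ, ‖f u‖ₑ ^ 2 := by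
  have h1 : ∀ t, ‖∫ u in t..(t + h), f u‖ₑ ^ 2 ≤
      ENNReal.ofReal h * ∫⁻ u in Set.Ioc t (t + h), ‖f u‖ₑ ^ 2 := by
    intro t
    rw [intervalIntegral.integral_of_le (by linarith)]
    refine (pow_le_pow_left' (enorm_integral_le_lintegral_enorm _) 2).trans ?_
    refine (sq_lintegral_le _ hf.enorm.measurable.aemeasurable).trans (le_of_eq ?_)
    simp
  have hF : Measurable fun u => ‖f u‖ₑ ^ 2 := hf.enorm.measurable.pow_const 2
  -- Tonelli: a point u lies in the windows (t, t + h] for t in an interval of length h, and t ≤ ρ -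
  -- h forces u ≤ ρ.
  have h2 : ∫⁻ t in Set.Iic (ρ - h), ∫⁻ u in Set.Ioc t (t + h), ‖f u‖ₑ ^ 2 ≤
      ENNReal.ofReal h * ∫⁻ u in Set.Iic ρ, ‖f u‖ₑ ^ 2 := by
    have hset : MeasurableSet {x : ℝ × ℝ | x.1 < x.2 ∧ x.2 ≤ x.1 + h} :=
      (measurableSet_lt measurable_fst measurable_snd).inter
        (measurableSet_le measurable_snd (measurable_fst.add_const h))
    have hmeas : Measurable (Set.indicator {x : ℝ × ℝ | x.1 < x.2 ∧ x.2 ≤ x.1 + h}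
        fun x => ‖f x.2‖ₑ ^ 2) := (hF.comp measurable_snd).indicator hset
    calc ∫⁻ t in Set.Iic (ρ - h), ∫⁻ u in Set.Ioc t (t + h), ‖f u‖ₑ ^ 2
        = ∫⁻ t in Set.Iic (ρ - h), ∫⁻ u, Set.indicator
            {x : ℝ × ℝ | x.1 < x.2 ∧ x.2 ≤ x.1 + h} (fun x => ‖f x.2‖ₑ ^ 2) (t, u) := by
          refine lintegral_congr fun t => ?_
          rw [← lintegral_indicator measurableSet_Ioc]
          rfl
      _ = ∫⁻ u, ∫⁻ t in Set.Iic (ρ - h), Set.indicator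
            {x : ℝ × ℝ | x.1 < x.2 ∧ x.2 ≤ x.1 + h} (fun x => ‖f x.2‖ₑ ^ 2) (t, u) :=
          lintegral_lintegral_swap hmeas.aemeasurable
      _ ≤ ∫⁻ u, ENNReal.ofReal h * Set.indicator (Set.Iic ρ) (fun u => ‖f u‖ₑ ^ 2) u := by
          refine lintegral_mono fun u => ?_
          calc ∫⁻ t in Set.Iic (ρ - h), Set.indicator
                {x : ℝ × ℝ | x.1 < x.2 ∧ x.2 ≤ x.1 + h} (fun x => ‖f x.2‖ₑ ^ 2) (t, u)
              ≤ ∫⁻ t, Set.indicator (Set.Ico (u - h) u)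
                (fun _ => Set.indicator (Set.Iic ρ) (fun u => ‖f u‖ₑ ^ 2) u) t := by
                rw [← lintegral_indicator measurableSet_Iic]
                refine lintegral_mono fun t => ?_
                by_cases ht : t ≤ ρ - h
                · by_cases hu : t < u ∧ u ≤ t + h
                  · have hm : t ∈ Set.Ico (u - h) u := ⟨by linarith [hu.2], hu.1⟩
                    have hm' : u ∈ Set.Iic ρ := by
                      simp only [Set.mem_Iic]; linarith [hu.2]
                    simp [Set.indicator_of_mem hm',
                      Set.indicator_of_mem (show t ∈ Set.Iic (ρ - h) from ht), hu]
                  · rw [Set.indicator_of_mem (show t ∈ Set.Iic (ρ - h) from ht),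
                      Set.indicator_of_notMem (by exact hu)]
                    exact zero_le
                · rw [Set.indicator_of_notMem (by exact ht)]
                  exact zero_le
            _ = _ := by
                rw [lintegral_indicator measurableSet_Ico]
                simp [mul_comm]
      _ = ENNReal.ofReal h * ∫⁻ u in Set.Iic ρ, ‖f u‖ₑ ^ 2 := by
          rw [lintegral_const_mul _ (hF.indicator measurableSet_Iic),
            lintegral_indicator measurableSet_Iic]
  calc ∫⁻ t in Set.Iic (ρ - h), ‖∫ u in t..(t + h), f u‖ₑ ^ 2
      ≤ ∫⁻ t in Set.Iic (ρ - h), ENNReal.ofReal h *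
          ∫⁻ u in Set.Ioc t (t + h), ‖f u‖ₑ ^ 2 := lintegral_mono h1
    _ = ENNReal.ofReal h * ∫⁻ t in Set.Iic (ρ - h),
          ∫⁻ u in Set.Ioc t (t + h), ‖f u‖ₑ ^ 2 :=
        lintegral_const_mul' _ _ ENNReal.ofReal_ne_top
    _ ≤ ENNReal.ofReal h * (ENNReal.ofReal h * ∫⁻ u in Set.Iic ρ, ‖f u‖ₑ ^ 2) := by gcongr
    _ = _ := by rw [sq, mul_assoc]

/-- A function whose increments are bounded in mean square is square integrable. -/
lemma lintegral_sq_le_of_increment_le {f : ℝ → ℂ} (hf : Integrable f) {C : ENNReal}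
    (hC : ∀ h, 0 < h → ∫⁻ t in Set.Iic (ρ - h), ‖∫ u in t..(t + h), f u‖ₑ ^ 2 ≤
      ENNReal.ofReal h ^ 2 * C) :
    ∫⁻ t in Set.Iio ρ, ‖f t‖ₑ ^ 2 ≤ C := by
  set δ : ℕ → ℝ := fun k => 1 / ((k : ℝ) + 1) with hδ
  have hδ0 : ∀ k, 0 < δ k := fun k => by simp only [hδ]; positivity
  have hδt : Tendsto δ atTop (𝓝 0) := tendsto_one_div_add_atTop_nhds_zero_nat
  have hδt' : Tendsto δ atTop (𝓝[≠] 0) :=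
    tendsto_nhdsWithin_iff.2 ⟨hδt, Eventually.of_forall fun k => (hδ0 k).ne'⟩
  -- Averages over shrinking windows converge almost everywhere by Lebesgue differentiation, and
  -- Fatou's lemma passes to the limit. The cutoff at ρ - δ k keeps each window below ρ.
  set g : ℕ → ℝ → ENNReal := fun k => Set.indicator (Set.Iic (ρ - δ k))
    fun t => ‖(δ k)⁻¹ • ∫ u in t..(t + δ k), f u‖ₑ ^ 2 with hg
  have hprim : ∀ k, Continuous fun t => ∫ u in t..(t + δ k), f u := by
    intro k
    have h1 : (fun t => ∫ u in t..(t + δ k), f u) =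
        fun t => (∫ u in (0 : ℝ)..(t + δ k), f u) - ∫ u in (0 : ℝ)..t, f u := by
      ext t
      rw [intervalIntegral.integral_interval_sub_left hf.intervalIntegrable hf.intervalIntegrable]
    have h2 := hf.continuous_primitive 0
    rw [h1]
    exact (h2.comp (continuous_id.add continuous_const)).sub h2
  have hgm : ∀ k, Measurable (g k) := fun k =>
    ((((hprim k).const_smul ((δ k)⁻¹)).enorm.measurable).pow_const 2).indicator measurableSet_Iic
  have hgC : ∀ k, ∫⁻ t, g k t ≤ C := by
    intro k
    rw [hg, lintegral_indicator measurableSet_Iic]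
    simp only [enorm_smul, mul_pow]
    rw [lintegral_const_mul _ ((hprim k).enorm.measurable.pow_const 2)]
    refine (mul_le_mul_right (hC _ (hδ0 k)) _).trans (le_of_eq ?_)
    rw [← mul_assoc, ← mul_pow, Real.enorm_eq_ofReal (inv_nonneg.2 (hδ0 k).le),
      ← ENNReal.ofReal_mul (inv_nonneg.2 (hδ0 k).le), inv_mul_cancel₀ (hδ0 k).ne']
    simp
  have hlim : ∀ᵐ t, t ∈ Set.Iio ρ → Tendsto (fun k => g k t) atTop (𝓝 (‖f t‖ₑ ^ 2)) := by
    filter_upwards [LocallyIntegrable.ae_hasDerivAt_integral hf.locallyIntegrable] with t ht htρ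
    have h1 := (ht t).tendsto_slope_zero.comp hδt'
    simp only [intervalIntegral.integral_same, sub_zero] at h1
    refine ((ENNReal.continuous_pow 2).tendsto _).comp h1.enorm |>.congr' ?_
    have h2 : ∀ᶠ k in atTop, δ k < ρ - t := hδt.eventually (gt_mem_nhds (sub_pos.2 htρ))
    filter_upwards [h2] with k hk
    have hm : t ∈ Set.Iic (ρ - δ k) := by simp only [Set.mem_Iic]; linarith
    simp only [hg, Set.indicator_of_mem hm]
    rfl
  calc ∫⁻ t in Set.Iio ρ, ‖f t‖ₑ ^ 2
      = ∫⁻ t in Set.Iio ρ, liminf (fun k => g k t) atTop := by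
        refine setLIntegral_congr_fun_ae measurableSet_Iio ?_
        filter_upwards [hlim] with t ht htρ
        exact (ht htρ).liminf_eq.symm
    _ ≤ liminf (fun k => ∫⁻ t in Set.Iio ρ, g k t) atTop := lintegral_liminf_le hgm
    _ ≤ C := by
        refine liminf_le_of_frequently_le' (Frequently.of_forall fun k => ?_)
        exact (setLIntegral_le_lintegral _ _).trans (hgC k)

/-- The lower bound in the energy identity for large imaginary frequencies. -/
lemma lintegral_sq_le_of_tendsto (hq : Integrable q) {L : ℝ}
    (hL : Tendsto (fun n : ℕ => (n : ℝ) * (1 - ‖jostX q (Complex.I * (n : ℝ)) ρ‖ ^ 2))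
      atTop (𝓝 L)) :
    ∫⁻ t in Set.Iio ρ, ‖q t‖ₑ ^ 2 ≤ ENNReal.ofReal L := by
  have him : ∀ n : ℕ, (Complex.I * (n : ℝ) : ℂ).im = n := fun n => by simp
  have him0 : ∀ n : ℕ, 0 ≤ (Complex.I * (n : ℝ) : ℂ).im := fun n => by rw [him]; positivity
  set X : ℕ → ℝ → ℂ := fun n => jostX q (Complex.I * (n : ℝ)) with hX
  set Y : ℕ → ℝ → ℂ := fun n => jostY q (Complex.I * (n : ℝ)) with hY
  have hYc : ∀ n, Continuous (Y n) := fun n => continuous_jostY hq (him0 n)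
  have hqc : Integrable fun s => (starRingEnd ℂ) (q s) :=
    (Complex.conjCLE : ℂ →L[ℝ] ℂ).integrable_comp hq
  have hunif : ∀ ε > 0, ∀ᶠ n : ℕ in atTop, ∀ t, ‖X n t - 1‖ ≤ ε ∧ ‖Y n t‖ ≤ ε := by
    intro ε hε
    obtain ⟨R, hR⟩ := exists_norm_jost_sub_le hq hε
    filter_upwards [tendsto_natCast_atTop_atTop.eventually (eventually_ge_atTop R)] with n hn t
    exact hR _ (him0 n) (by simpa using hn) t
  have hXt : ∀ t, Tendsto (fun n => X n t) atTop (𝓝 1) := fun t =>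
    Metric.nhds_basis_closedBall.tendsto_right_iff.2 fun ε hε => by
      filter_upwards [hunif ε hε] with n hn
      rw [mem_closedBall_iff_norm]
      exact (hn t).1
  have hYt : ∀ t, Tendsto (fun n => Y n t) atTop (𝓝 0) := fun t =>
    Metric.nhds_basis_closedBall.tendsto_right_iff.2 fun ε hε => by
      filter_upwards [hunif ε hε] with n hn
      rw [mem_closedBall_zero_iff]
      exact (hn t).2
  -- This is the dissipation bound 4n∫|Y|² ≤ 1 - |X(ρ)|² multiplied by n.
  have hYb : ∀ n : ℕ, ∫⁻ u in Set.Iic ρ, ‖(2 * (n : ℂ)) * Y n u‖ₑ ^ 2 ≤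
      ENNReal.ofReal ((n : ℝ) * (1 - ‖X n ρ‖ ^ 2)) := by
    intro n
    have hc : Continuous fun u => ‖(2 * (n : ℂ)) * Y n u‖ ^ 2 :=
      ((continuous_const.mul (hYc n)).norm.pow 2)
    have hb : ∀ a, ∫ u in a..ρ, ‖(2 * (n : ℂ)) * Y n u‖ ^ 2 ≤ (n : ℝ) * (1 - ‖X n ρ‖ ^ 2) := by
      intro a
      have h1 := integral_norm_sq_jostY_le hq (him0 n) a ρ
      rw [him] at h1
      have h2 : ∫ u in a..ρ, ‖(2 * (n : ℂ)) * Y n u‖ ^ 2 =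
          n * (4 * n * ∫ u in a..ρ, ‖Y n u‖ ^ 2) := by
        rw [← intervalIntegral.integral_const_mul, ← intervalIntegral.integral_const_mul]
        congr 1
        ext u
        simp [mul_pow]
        ring
      rw [h2]
      exact mul_le_mul_of_nonneg_left h1 (Nat.cast_nonneg n)
    have hint : IntegrableOn (fun u => ‖(2 * (n : ℂ)) * Y n u‖ ^ 2) (Set.Iic ρ) := by
      refine integrableOn_Iic_of_intervalIntegral_norm_bounded ((n : ℝ) * (1 - ‖X n ρ‖ ^ 2)) ρ
        (fun a => (hc.integrableOn_Icc.mono_set Set.Ioc_subset_Icc_self)) (tendsto_id (x := atBot))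
        (Eventually.of_forall fun a => ?_)
      simpa using hb a
    have h1 : ∀ u, ‖(2 * (n : ℂ)) * Y n u‖ₑ ^ 2 =
        ENNReal.ofReal (‖(2 * (n : ℂ)) * Y n u‖ ^ 2) := fun u => by
      rw [ENNReal.ofReal_pow (norm_nonneg _), ofReal_norm]
    simp only [h1]
    rw [← ofReal_integral_eq_lintegral_ofReal hint (Eventually.of_forall fun _ => by positivity)]
    refine ENNReal.ofReal_le_ofReal ?_
    exact le_of_tendsto (intervalIntegral_tendsto_integral_Iic ρ hint (tendsto_id (x := atBot)))
      (Eventually.of_forall hb)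
  have hLof : Tendsto (fun n : ℕ => ENNReal.ofReal ((n : ℝ) * (1 - ‖X n ρ‖ ^ 2))) atTop
      (𝓝 (ENNReal.ofReal L)) := (ENNReal.continuous_ofReal.tendsto _).comp hL
  -- At ξ = in the second equation reads 2nY = -q̄X - Y'. Integrated, the boundary terms vanish in
  -- the limit and X → 1.
  have hconv : ∀ a b, Tendsto (fun n : ℕ => ∫ u in a..b, (2 * (n : ℂ)) * Y n u) atTop
      (𝓝 (-∫ u in a..b, (starRingEnd ℂ) (q u))) := by
    intro a b
    have h1 : ∀ n : ℕ, ∫ u in a..b, (2 * (n : ℂ)) * Y n u =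
        -(∫ u in a..b, (starRingEnd ℂ) (q u) * X n u) - (Y n b - Y n a) := by
      intro n
      have hi : IntervalIntegrable (fun u => (starRingEnd ℂ) (q u) * X n u) volume a b :=
        hqc.intervalIntegrable.mul_continuousOn (continuous_jostX hq (him0 n)).continuousOn
      have hin : IntervalIntegrable (fun u => -((starRingEnd ℂ) (q u) * X n u)) volume a b :=
        hi.neg
      have hYac := isACPrimitive_jostY hq (him0 n)
      rw [hYac.2 a b, ← intervalIntegral.integral_neg,
        ← intervalIntegral.integral_sub hin (hYac.1 a b)]
      congr 1
      ext u
      push_cast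
      linear_combination (2 * (n : ℂ) * Y n u) * Complex.I_sq
    simp only [h1]
    have h2 : Tendsto (fun n : ℕ => ∫ u in a..b, (starRingEnd ℂ) (q u) * X n u) atTop
        (𝓝 (∫ u in a..b, (starRingEnd ℂ) (q u))) := by
      refine intervalIntegral.tendsto_integral_filter_of_dominated_convergence (fun u => ‖q u‖)
        (Eventually.of_forall fun n => ?_) (Eventually.of_forall fun n => ?_)
        hq.norm.intervalIntegrable (Eventually.of_forall fun u _ => ?_)
      · exact (hqc.aestronglyMeasurable.mul
          (continuous_jostX hq (him0 n)).aestronglyMeasurable).restrict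
      · refine Eventually.of_forall fun u _ => ?_
        rw [norm_mul, RCLike.norm_conj]
        exact mul_le_of_le_one_right (norm_nonneg _) (norm_jostX_le_one hq (him0 n) u)
      · simpa using (hXt u).const_mul ((starRingEnd ℂ) (q u))
    simpa using h2.neg.sub ((hYt b).sub (hYt a))
  have hmain := lintegral_sq_le_of_increment_le (ρ := ρ) hqc (C := ENNReal.ofReal L) ?_
  · simpa [← ofReal_norm] using hmain
  · intro h hh
    have hmeas : ∀ n : ℕ, Measurable fun t => ‖∫ u in t..(t + h), (2 * (n : ℂ)) * Y n u‖ₑ ^ 2 := by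
      intro n
      have hc : Continuous fun u => (2 * (n : ℂ)) * Y n u := continuous_const.mul (hYc n)
      have h1 : (fun t => ∫ u in t..(t + h), (2 * (n : ℂ)) * Y n u) =
          fun t => (∫ u in (0 : ℝ)..(t + h), (2 * (n : ℂ)) * Y n u) -
            ∫ u in (0 : ℝ)..t, (2 * (n : ℂ)) * Y n u := by
        ext t
        rw [intervalIntegral.integral_interval_sub_left (hc.intervalIntegrable _ _)
          (hc.intervalIntegrable _ _)]
      have h2 := intervalIntegral.continuous_primitive (μ := volume)
        (fun a b => hc.intervalIntegrable a b) 0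
      have h3 : Continuous fun t => ∫ u in t..(t + h), (2 * (n : ℂ)) * Y n u := by
        rw [h1]
        exact (h2.comp (continuous_id.add continuous_const)).sub h2
      exact h3.enorm.measurable.pow_const 2
    -- Only integrals of 2nY over intervals converge, so Fatou's lemma is applied to increments
    -- rather than to 2nY itself.
    calc ∫⁻ t in Set.Iic (ρ - h), ‖∫ u in t..(t + h), (starRingEnd ℂ) (q u)‖ₑ ^ 2
        = ∫⁻ t in Set.Iic (ρ - h), liminf
            (fun n : ℕ => ‖∫ u in t..(t + h), (2 * (n : ℂ)) * Y n u‖ₑ ^ 2) atTop := by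
          refine lintegral_congr fun t => ?_
          have h1 := ((ENNReal.continuous_pow 2).tendsto _).comp (hconv t (t + h)).enorm
          rw [enorm_neg] at h1
          exact h1.liminf_eq.symm
      _ ≤ liminf (fun n : ℕ => ∫⁻ t in Set.Iic (ρ - h),
            ‖∫ u in t..(t + h), (2 * (n : ℂ)) * Y n u‖ₑ ^ 2) atTop := lintegral_liminf_le hmeas
      _ ≤ liminf (fun n : ℕ => ENNReal.ofReal h ^ 2 *
            ENNReal.ofReal ((n : ℝ) * (1 - ‖X n ρ‖ ^ 2))) atTop := by
          refine liminf_le_liminf (Eventually.of_forall fun n => ?_)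
          refine (lintegral_sq_increment_le (continuous_const.mul (hYc n)) hh).trans ?_
          gcongr
          exact hYb n
      _ = ENNReal.ofReal h ^ 2 * ENNReal.ofReal L :=
          (ENNReal.Tendsto.const_mul hLof (Or.inr (by simp))).liminf_eq

end Energy

/-! ### Asymptotics at large imaginary frequencies -/

/-- A first-order expansion at 0, since convergence of n·uₙ forces uₙ → 0. `dslope` also covers the
indices with uₙ = 0. -/
lemma tendsto_mul_comp_of_hasDerivAt {f : ℝ → ℝ} {f' c : ℝ} (hf : HasDerivAt f f' 0)
    (hf0 : f 0 = 0) {u : ℕ → ℝ} (hu : Tendsto (fun n : ℕ => (n : ℝ) * u n) atTop (𝓝 c)) :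
    Tendsto (fun n : ℕ => (n : ℝ) * f (u n)) atTop (𝓝 (f' * c)) := by
  have hu0 : Tendsto u atTop (𝓝 0) := by
    have h := tendsto_inv_atTop_nhds_zero_nat (𝕜 := ℝ) |>.mul hu
    rw [zero_mul] at h
    refine h.congr' ?_
    filter_upwards [eventually_ge_atTop 1] with n hn
    have : (n : ℝ) ≠ 0 := by positivity
    field_simp
  have hd : Tendsto (fun n => dslope f 0 (u n)) atTop (𝓝 f') := by
    have h := (continuousAt_dslope_same.2 hf.differentiableAt).tendsto.comp hu0
    rwa [dslope_same, hf.deriv] at h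
  refine (hd.mul hu).congr fun n => ?_
  have h := sub_smul_dslope f 0 (u n)
  rw [hf0, sub_zero, sub_zero, smul_eq_mul] at h
  rw [← h]
  ring

/-- The squared modulus of the factor is 1 - u with u = 4n Im p / ((Re p)² + (n + Im p)²), and
-log(1 - u) behaves like u. -/
lemma tendsto_mul_log_blaschke {p : ℂ} (hp : 0 < p.im) :
    Tendsto (fun n : ℕ => (n : ℝ) * (-2 * Real.log
      ‖(Complex.I * (n : ℝ) - p) / (Complex.I * (n : ℝ) - (starRingEnd ℂ) p)‖)) atTop
      (𝓝 (4 * p.im)) := by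
  set u : ℕ → ℝ := fun n => 4 * n * p.im / (p.re ^ 2 + (n + p.im) ^ 2) with hu
  have hden : ∀ n : ℕ, 0 < p.re ^ 2 + ((n : ℝ) + p.im) ^ 2 := fun n => by positivity
  have hlim : Tendsto (fun n : ℕ => (n : ℝ) * u n) atTop (𝓝 (4 * p.im)) := by
    have hi := tendsto_inv_atTop_nhds_zero_nat (𝕜 := ℝ)
    have h1 : Tendsto (fun n : ℕ => 4 * p.im /
        (p.re ^ 2 * ((n : ℝ)⁻¹) ^ 2 + (1 + p.im * (n : ℝ)⁻¹) ^ 2)) atTop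
        (𝓝 (4 * p.im / (p.re ^ 2 * 0 ^ 2 + (1 + p.im * 0) ^ 2))) :=
      tendsto_const_nhds.div (((hi.pow 2).const_mul _).add
        ((tendsto_const_nhds.add (hi.const_mul _)).pow 2)) (by norm_num)
    have h2 : 4 * p.im / (p.re ^ 2 * 0 ^ 2 + (1 + p.im * 0) ^ 2) = 4 * p.im := by norm_num
    rw [h2] at h1
    refine h1.congr' ?_
    filter_upwards [eventually_ge_atTop 1] with n hn
    have hn0 : (n : ℝ) ≠ 0 := by positivity
    have h3 : p.re ^ 2 * ((n : ℝ)⁻¹) ^ 2 + (1 + p.im * (n : ℝ)⁻¹) ^ 2 =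
        (p.re ^ 2 + ((n : ℝ) + p.im) ^ 2) / (n : ℝ) ^ 2 := by
      field_simp
    rw [h3, hu]
    have := (hden n).ne'
    field_simp
  have hder : HasDerivAt (fun x : ℝ => -Real.log (1 - x)) 1 0 := by
    have h := (((hasDerivAt_id (0 : ℝ)).const_sub 1).log (by norm_num)).fun_neg
    simpa using h
  have h := tendsto_mul_comp_of_hasDerivAt hder (by simp) hlim
  rw [one_mul] at h
  refine h.congr fun n => ?_
  have h1 : 1 - u n = ‖(Complex.I * (n : ℝ) - p) /
      (Complex.I * (n : ℝ) - (starRingEnd ℂ) p)‖ ^ 2 := by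
    rw [norm_div, div_pow, ← Complex.normSq_eq_norm_sq, ← Complex.normSq_eq_norm_sq,
      Complex.normSq_apply, Complex.normSq_apply, hu, eq_div_iff, sub_mul, div_mul_eq_mul_div]
    · simp only [Complex.sub_re, Complex.sub_im, Complex.mul_re, Complex.mul_im, Complex.I_re,
        Complex.I_im, Complex.ofReal_re, Complex.ofReal_im, Complex.conj_re, Complex.conj_im]
      have := (hden n).ne'
      field_simp
      ring
    · have := hden n
      simp
      nlinarith
  rw [h1, Real.log_pow]
  push_cast
  ring

/-- Domination by |r|², from log(1 + x) ≤ x. -/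
lemma integrable_log_one_add_sq {r : ℝ → ℂ} (hr : MemLp r 2 volume) :
    Integrable fun ξ : ℝ => Real.log (1 + ‖r ξ‖ ^ 2) := by
  refine Integrable.mono' (hr.integrable_norm_pow (by norm_num)) ?_
    (Eventually.of_forall fun ξ => ?_)
  · exact (Real.measurable_log.comp_aemeasurable
      ((hr.1.norm.aemeasurable.pow_const 2).const_add 1)).aestronglyMeasurable
  · rw [Real.norm_of_nonneg (Real.log_nonneg (by nlinarith [sq_nonneg ‖r ξ‖]))]
    refine (Real.log_le_sub_one_of_pos (by positivity)).trans (le_of_eq ?_)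
    simp

/-- Poisson means of an integrable function at large heights. -/
lemma tendsto_poisson_integral {g : ℝ → ℝ} (hg : Integrable g) :
    Tendsto (fun n : ℕ => (n : ℝ) * ∫ x : ℝ, g x * ((n : ℝ) / (x ^ 2 + (n : ℝ) ^ 2))) atTop
      (𝓝 (∫ x, g x)) := by
  have h1 : ∀ n : ℕ, (n : ℝ) * ∫ x : ℝ, g x * ((n : ℝ) / (x ^ 2 + (n : ℝ) ^ 2)) =
      ∫ x : ℝ, g x * ((n : ℝ) ^ 2 / (x ^ 2 + (n : ℝ) ^ 2)) := fun n => by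
    rw [← integral_const_mul]
    congr 1
    ext x
    ring
  simp only [h1]
  refine tendsto_integral_of_dominated_convergence (fun x => ‖g x‖) (fun n => ?_) hg.norm
    (fun n => Eventually.of_forall fun x => ?_) (Eventually.of_forall fun x => ?_)
  · exact hg.aestronglyMeasurable.mul (Measurable.aestronglyMeasurable (by fun_prop))
  · rw [norm_mul]
    refine mul_le_of_le_one_right (norm_nonneg _) ?_
    rw [Real.norm_of_nonneg (by positivity)]
    exact div_le_one_of_le₀ (by nlinarith [sq_nonneg x]) (by positivity)
  · have hi := tendsto_inv_atTop_nhds_zero_nat (𝕜 := ℝ)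
    have h2 : Tendsto (fun n : ℕ => 1 / (x ^ 2 * ((n : ℝ)⁻¹) ^ 2 + 1)) atTop
        (𝓝 (1 / (x ^ 2 * 0 ^ 2 + 1))) :=
      tendsto_const_nhds.div (((hi.pow 2).const_mul _).add tendsto_const_nhds) (by norm_num)
    have h3 : Tendsto (fun n : ℕ => (n : ℝ) ^ 2 / (x ^ 2 + (n : ℝ) ^ 2)) atTop (𝓝 1) := by
      have h4 : (1 : ℝ) / (x ^ 2 * 0 ^ 2 + 1) = 1 := by norm_num
      rw [h4] at h2
      refine h2.congr' ?_
      filter_upwards [eventually_ge_atTop 1] with n hn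
      have hn0 : (n : ℝ) ≠ 0 := by positivity
      have h5 : x ^ 2 + (n : ℝ) ^ 2 ≠ 0 := by positivity
      field_simp
    simpa using h3.const_mul (g x)

end

/-! ### The energy formula -/

theorem mainTheorem5
    (M : ℝ → Fin 3 → ℝ) (hM : ∀ z, M z ⬝ᵥ M z = 1) (hMz : ∀ z, M z 2 ≠ -1)
    (hr : MemH1 (reflectionCoefficient M))
    (hξr : MemH1 (fun ξ : ℝ => (ξ : ℂ) * reflectionCoefficient M ξ))
    (ρ : ℝ) (r₀ : ℝ → ℂ)
    (hr₀ : ∀ ξ : ℝ, reflectionCoefficient M ξ =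
      Complex.exp (-2 * Complex.I * (ξ : ℂ) * (ρ : ℂ)) * r₀ ξ)
    (R₀ : ℂ → ℂ) (hR₀ : IsMeromorphicExtension r₀ R₀) (hlim : VanishesAtInfinityUpper R₀)
    (m : ℕ) (p : Fin m → ℂ) (d : Fin m → ℕ) (hpoles : ArePolesUpper R₀ p d)
    (ω : ℝ → ℂ) (hω : Integrable ω) (hρ : HasRephasingTime ω ρ)
    (hT : IsSelectiveExcitation ω M) :
    Integrable (fun t => ‖ω t‖ ^ 2) ∧
    Integrable (fun ξ : ℝ => Real.log (1 + ‖reflectionCoefficient M ξ‖ ^ 2)) ∧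
    pulseEnergy ω =
      4 / Real.pi * (∫ ξ : ℝ, Real.log (1 + ‖reflectionCoefficient M ξ‖ ^ 2)) +
        16 * ∑ k, (d k : ℝ) * (p k).im := by
  have hlog := integrable_log_one_add_sq hr.1
  set q := spinorPotential ω with hqdef
  have hq : Integrable q := integrable_spinorPotential hω
  set A : ℂ → ℂ := fun ξ => jostX q ξ ρ with hA
  set B : ℂ → ℂ := fun ξ => jostY q ξ ρ with hB
  have hrefl := reflectionCoefficient_eq hω hρ hT hMz
  have hA0 : ∀ x : ℝ, A x ≠ 0 := fun x => (hrefl x).1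
  have hr0 : ∀ x : ℝ, r₀ x * A x = B x := by
    intro x
    have h1 := (hr₀ x).symm.trans (hrefl x).2
    rw [mul_left_cancel₀ (Complex.exp_ne_zero _) h1]
    exact div_mul_cancel₀ _ (hA0 x)
  have hAd : DifferentiableOn ℂ A {z : ℂ | 0 < z.im} := differentiableOn_jostX hq ρ
  have hBd : DifferentiableOn ℂ B {z : ℂ | 0 < z.im} := differentiableOn_jostY hq ρ
  have hAb : ∀ x : ℝ, Tendsto A (𝓝[{z : ℂ | 0 < z.im}] (x : ℂ)) (𝓝 (A x)) :=
    tendsto_nhdsWithin_ofReal_of_continuousOn (continuousOn_jostX hq ρ)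
  have hBb : ∀ x : ℝ, Tendsto B (𝓝[{z : ℂ | 0 < z.im}] (x : ℂ)) (𝓝 (r₀ x * A x)) := by
    intro x
    rw [hr0]
    exact tendsto_nhdsWithin_ofReal_of_continuousOn (continuousOn_jostY hq ρ) x
  obtain ⟨hAc, hBc⟩ := tendsto_jost_cobounded hq ρ
  have hmul : ∀ z : ℂ, 0 < z.im → ∀ᶠ w in 𝓝[≠] z, R₀ w * A w = B w := fun z hz =>
    eventually_mul_eq_of_boundary (a := fun x => A x) hR₀ hlim hpoles hAd hAb hAc hBd hBb hBc hz
  have hAB : ∀ z : ℂ, 0 < z.im → A z = 0 → B z ≠ 0 := by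
    intro z hz h1 h2
    have h3 := norm_sq_jost_pos hq hz.le ρ
    simp only [hA, hB] at h1 h2
    rw [h1, h2] at h3
    simp at h3
  obtain ⟨hord, hAne⟩ := zeros_of_eventually_mul_eq hR₀.1 hpoles hAd hBd hAB hmul
  have hp : ∀ k, 0 < (p k).im := fun k => ((hpoles.2.1 _).1 ⟨k, rfl⟩).1
  -- On the real line |r| = |B|/|A| and |A|² + |B|² = 1, hence 1 + |r|² = |A|⁻².
  have hlogA : ∀ x : ℝ, Real.log ‖A x‖ =
      -1 / 2 * Real.log (1 + ‖reflectionCoefficient M x‖ ^ 2) := by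
    intro x
    have h1 : ‖A x‖ ^ 2 + ‖B x‖ ^ 2 = 1 := norm_sq_jost_ofReal hq x ρ
    have h2 : ‖reflectionCoefficient M x‖ = ‖B x‖ / ‖A x‖ := by
      rw [(hrefl x).2, norm_mul, norm_div, Complex.norm_exp]
      simp [hA, hB, hqdef]
    have h3 : ‖A x‖ ≠ 0 := norm_ne_zero_iff.2 (hA0 x)
    have h4 : 1 + ‖reflectionCoefficient M x‖ ^ 2 = (‖A x‖ ^ 2)⁻¹ := by
      rw [h2]
      field_simp
      linarith
    rw [h4, Real.log_inv, Real.log_pow]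
    push_cast
    ring
  set L : ℝ := 1 / Real.pi * (∫ ξ : ℝ, Real.log (1 + ‖reflectionCoefficient M ξ‖ ^ 2)) +
    ∑ k, (d k : ℝ) * (4 * (p k).im) with hL
  -- For large n the point in lies above all zeros of A, so the logarithm there is meaningful.
  have hev : ∀ᶠ n : ℕ in atTop, 0 < (n : ℝ) ∧ Complex.I * (n : ℝ) ∉ Set.range p := by
    obtain ⟨K, hK⟩ := (Set.finite_range fun k => (p k).im).bddAbove
    filter_upwards [tendsto_natCast_atTop_atTop.eventually (eventually_gt_atTop (max K 0))]
      with n hn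
    refine ⟨(le_max_right _ _).trans_lt hn, ?_⟩
    rintro ⟨k, hk⟩
    have h1 := hK ⟨k, rfl⟩
    simp only [hk] at h1
    simp at h1
    linarith [le_max_left K 0]
  have hlogT : Tendsto (fun n : ℕ => (n : ℝ) * (-2 * Real.log ‖A (Complex.I * (n : ℝ))‖)) atTop
      (𝓝 L) := by
    have h1 := ((tendsto_poisson_integral hlog).const_mul (1 / Real.pi)).add
      (tendsto_finsetSum Finset.univ fun k _ =>
        (tendsto_mul_log_blaschke (hp k)).const_mul (d k : ℝ))
    refine h1.congr' ?_
    filter_upwards [hev] with n hn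
    rw [log_norm_eq_poisson_add_sum (a := fun x => A x) hAd hAb hAc hA0 one_ne_zero hpoles.1 hp
      hord hAne hn.1 hn.2]
    simp only [hlogA, mul_assoc (-1 / 2 : ℝ), integral_const_mul]
    rw [mul_add, mul_add, Finset.mul_sum, Finset.mul_sum]
    congr 1
    · ring
    · exact Finset.sum_congr rfl fun k _ => by ring
  have hT2 : Tendsto (fun n : ℕ => (n : ℝ) * (1 - ‖jostX q (Complex.I * (n : ℝ)) ρ‖ ^ 2)) atTop
      (𝓝 L) := by
    -- With x = -2 log|A|, the function 1 - e^{-x} is 1 - |A|², and its unit derivative at 0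
    -- preserves the limit L.
    have hder : HasDerivAt (fun x : ℝ => 1 - Real.exp (-x)) 1 0 := by
      have h := ((hasDerivAt_neg (0 : ℝ)).exp).const_sub 1
      simpa using h
    have h1 := tendsto_mul_comp_of_hasDerivAt hder (by simp) hlogT
    rw [one_mul] at h1
    refine h1.congr' ?_
    filter_upwards [hev] with n hn
    have h2 : 0 < ‖A (Complex.I * (n : ℝ))‖ :=
      norm_pos_iff.2 (hAne _ (by simpa using hn.1) hn.2)
    have h3 : -(-2 * Real.log ‖A (Complex.I * (n : ℝ))‖) =
        Real.log (‖A (Complex.I * (n : ℝ))‖ ^ 2) := by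
      rw [Real.log_pow]
      push_cast
      ring
    rw [h3, Real.exp_log (by positivity)]
  have hL0 : 0 ≤ L := by
    refine ge_of_tendsto hT2 (Eventually.of_forall fun n => ?_)
    have h1 := norm_jostX_le_one hq (ξ := Complex.I * (n : ℝ)) (by simp) ρ
    have h2 : ‖jostX q (Complex.I * (n : ℝ)) ρ‖ ^ 2 ≤ 1 := pow_le_one₀ (norm_nonneg _) h1
    exact mul_nonneg (Nat.cast_nonneg n) (by linarith)
  -- This bound must come first: it makes q square integrable, which the opposite inequality
  -- assumes.
  have hlower : ∫⁻ t, ‖q t‖ₑ ^ 2 ≤ ENNReal.ofReal L := by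
    refine le_trans (le_of_eq ?_) (lintegral_sq_le_of_tendsto hq hT2)
    rw [← lintegral_indicator measurableSet_Iio]
    refine lintegral_congr_ae ?_
    filter_upwards [hρ, Measure.ae_ne volume ρ] with t ht hne
    by_cases h : t < ρ
    · rw [Set.indicator_of_mem (show t ∈ Set.Iio ρ from h)]
    · rw [Set.indicator_of_notMem (by exact h)]
      have h0 := ht (lt_of_le_of_ne (not_lt.1 h) hne.symm)
      simp [hqdef, spinorPotential, h0]
  have henorm : ∀ t, ‖q t‖ₑ ^ 2 = ENNReal.ofReal (‖q t‖ ^ 2) := fun t => by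
    rw [ENNReal.ofReal_pow (norm_nonneg _), ofReal_norm]
  simp only [henorm] at hlower
  have hq2m : AEStronglyMeasurable (fun t => ‖q t‖ ^ 2) volume :=
    (hq.aestronglyMeasurable.norm.pow 2)
  have hq2 : Integrable fun t => ‖q t‖ ^ 2 := by
    refine ⟨hq2m, ?_⟩
    rw [hasFiniteIntegral_iff_ofReal (Eventually.of_forall fun _ => by positivity)]
    exact hlower.trans_lt ENNReal.ofReal_lt_top
  have hle : ∫ t, ‖q t‖ ^ 2 ≤ L := by
    rw [integral_eq_lintegral_of_nonneg_ae (Eventually.of_forall fun _ => by positivity) hq2m]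
    exact ENNReal.toReal_le_of_le_ofReal hL0 hlower
  have hge : L ≤ ∫ t, ‖q t‖ ^ 2 := by
    refine le_of_tendsto hT2 ?_
    filter_upwards [hev] with n hn
    exact mul_one_sub_norm_sq_jostX_le hq hq2 hn.1 ρ
  have hωq : ∀ t, ‖ω t‖ ^ 2 = 4 * ‖q t‖ ^ 2 := by
    intro t
    have h1 : ‖q t‖ = 1 / 2 * ‖ω t‖ := by simp [hqdef, spinorPotential]
    rw [h1]
    ring
  refine ⟨?_, hlog, ?_⟩
  · simp only [hωq]
    exact hq2.const_mul 4
  · rw [pulseEnergy]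
    simp only [hωq]
    rw [integral_const_mul, le_antisymm hle hge, hL]
    have h1 : ∑ k, (d k : ℝ) * (4 * (p k).im) = 4 * ∑ k, (d k : ℝ) * (p k).im := by
      rw [Finset.mul_sum]
      exact Finset.sum_congr rfl fun k _ => by ring
    rw [h1]
    ring
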